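/- Let $T>0$, let $r\ge 2$ and $n\ge 1$ be integers, and let $\alpha_0,\dots,\alpha_n\in C^r[0,T]$ satisfy $\alpha_i(0)=0$, $\ 0=\alpha_0(t)<\alpha_1(t)<\dots<\alpha_{n-1}(t)<\alpha_n(t)=t$ for $0<t\le T$, with $\alpha_1,\dots,\alpha_{n-1}$ strictly increasing near $0$ and $0<\alpha_1'(0)\le\dots\le\alpha_{n-1}'(0)<1$. Let $K_1,\dots,K_n\in C^{r+1,r}([0,T]^2)$ (all mixed partial derivatives of order at most $r+1$ in $t$ and at most $r$ in $s$ exist and are continuous), with $K_n(t,t)\ne 0$ on $[0,T]$. Put $K(t,s)=K_i(t,s)$ for $\alpha_{i-1}(t)<s<\alpha_i(t)$. For $g\in C^{r+1}[0,T]$ with $g(0)=0$ set $$h(t,s)=-\frac{\partial_tK_i(t,s)}{K_n(t,t)}\quad(\alpha_{i-1}(t)<s<\alpha_i(t)),\qquad f(t)=\frac{g'(t)}{K_n(t,t)},$$ and consider the second-kind equation $$x(t)-\int_0^t h(t,s)x(s)\,ds=f(t),\qquad 0\le t\le T, \tag{1}$$ associated with the first-kind equation $\int_0^tK(t,s)x(s)\,ds=g(t)$,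 $0\le t\le T$. For $N\ge1$ let $t_k=kT/N$, $\Delta_k=[t_k,t_{k+1}]$, and let $P_r(u,\Delta_k)$ be the polynomial interpolating $u$ at the $r$ nodes consisting of the endpoints of $\Delta_k$ and the points $\frac{t_k+t_{k+1}}2+\frac{t_{k+1}-t_k}2\,y_j$, $1\le j\le r-2$, where the $y_j$ are the roots of the Legendre polynomial of degree $r-2$. A spline-collocation solution $x_N$ is a function on $[0,T]$ whose restriction $p_k$ to each $\Delta_k$, $k=0,\dots,N-1$, is a polynomial of degree at most $r-1$ with $$p_k-P_r\Big(\int_{t_k}^{\,\cdot}h(\cdot,s)p_k(s)\,ds,\ \Delta_k\Big)=P_r(f_k,\Delta_k),\qquad f_k(t)=f(t)+\sum_{l<k}\int_{t_l}^{t_{l+1}}h(t,s)x_N(s)\,ds .$$ Then there are $A>0$ and $N_0\ge1$, depending only on $T,r,n$, the $\alpha_i$ and the $K_i$, such that for every $g\in C^{r+1}[0,T]$ with $g(0)=0$: * A function $z\in C[0,T]$ with $\sum_{i=1}^{n-1}\alpha_i'(t)\,[K_i-K_{i+1}](t,\alpha_i(t))\,z(\alpha_i(t))=0$ on $[0,T]$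 (in particular, any $z\in C[0,T]$ when $K_i=K_{i+1}$ on each curve $s=\alpha_i(t)$, $1\le i<n$) solves the first-kind equation if and only if it solves (1). * Equation (1) has exactly one solution $x\in C[0,T]$, and $x\in C^r[0,T]$. * For every $N\ge N_0$ there is exactly one spline-collocation solution $x_N$; it is continuous, and $$\|x-x_N\|_{C[0,T]}\le A\,\frac{L_r\,(T/N)^r}{r!},\qquad L_r=\max_{[0,T]}|x^{(r)}| .$$ * If $x$ is not a polynomial of degree at most $r-1$ on $[0,T]$, then $\|x-x_N\|_{C[0,T]}\asymp N^{-r}$: there are $c,C>0$, independent of $N$, with $cN^{-r}\le\|x-x_N\|_{C[0,T]}\le CN^{-r}$ for all $N\ge N_0$. -/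

import Mathlib

open Polynomial Set

noncomputable section

namespace VolterraSpline

/-- The maximum norm of `C[0,T]`, for functions continuous on `[0,T]`. -/
def cNorm (T : ℝ) (u : ℝ → ℝ) : ℝ :=
  sSup ((fun t => |u t|) '' Icc 0 T)

/-- The class `C^{p,q}([0,T]²)`: all mixed partial derivatives of order at most `p` in the first
and at most `q` in the second variable exist (one-sided on the boundary) and are continuous on the
closed square. The function `D a b` is the derivative of order `a` in the first and `b` in the
second variable. -/
def MixedC (T : ℝ) (p q : ℕ) (F : ℝ → ℝ → ℝ) : Prop :=
  ∃ D : ℕ → ℕ → ℝ → ℝ → ℝ,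
    (∀ t ∈ Icc 0 T, ∀ s ∈ Icc 0 T, D 0 0 t s = F t s) ∧
    (∀ a ≤ p, ∀ b ≤ q, ContinuousOn (fun z : ℝ × ℝ => D a b z.1 z.2) (Icc 0 T ×ˢ Icc 0 T)) ∧
    (∀ a < p, ∀ b ≤ q, ∀ t ∈ Icc 0 T, ∀ s ∈ Icc 0 T,
      HasDerivWithinAt (fun τ => D a b τ s) (D (a + 1) b t s) (Icc 0 T) t) ∧
    (∀ a ≤ p, ∀ b < q, ∀ t ∈ Icc 0 T, ∀ s ∈ Icc 0 T,
      HasDerivWithinAt (fun σ => D a b t σ) (D a (b + 1) t s) (Icc 0 T) s)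

/-- Curves `0 = α₀(t) < α₁(t) < ⋯ < αₙ(t) = t`, of class `C^r` on `[0,T]`, all starting at `0`,
the interior ones increasing near `0` with slopes at `0` that are ordered and lie in `(0,1)`. -/
structure CurveSystem (T : ℝ) (r n : ℕ) (α : ℕ → ℝ → ℝ) : Prop where
  first : ∀ t ∈ Icc 0 T, α 0 t = 0
  last : ∀ t ∈ Icc 0 T, α n t = t
  smooth : ∀ i ≤ n, ContDiffOn ℝ r (α i) (Icc 0 T)
  at_zero : ∀ i ≤ n, α i 0 = 0
  lt : ∀ i < n, ∀ t ∈ Ioc 0 T, α i t < α (i + 1) t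
  increasing : ∃ τ ∈ Ioc 0 T, ∀ i, 1 ≤ i → i < n → StrictMonoOn (α i) (Icc 0 τ)
  slope_pos : ∀ i, 1 ≤ i → i < n → 0 < derivWithin (α i) (Icc 0 T) 0
  slope_lt_one : ∀ i, 1 ≤ i → i < n → derivWithin (α i) (Icc 0 T) 0 < 1
  slope_le : ∀ i, 1 ≤ i → i + 1 < n →
    derivWithin (α i) (Icc 0 T) 0 ≤ derivWithin (α (i + 1)) (Icc 0 T) 0

/-- The kernel with value `F i t s` for `α (i-1) t < s < α i t`, `1 ≤ i ≤ n` (and `0` elsewhere;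
the curves themselves do not matter under the integral sign). -/
def jumpKernel (n : ℕ) (α : ℕ → ℝ → ℝ) (F : ℕ → ℝ → ℝ → ℝ) (t s : ℝ) : ℝ :=
  ∑ i ∈ Finset.Icc 1 n, if α (i - 1) t < s ∧ s < α i t then F i t s else 0

/-- The first-kind equation `∫₀ᵗ K(t,s) x(s) ds = g(t)` on `[0,T]`. -/
def SolvesFirstKind (T : ℝ) (n : ℕ) (α : ℕ → ℝ → ℝ) (K : ℕ → ℝ → ℝ → ℝ)
    (g x : ℝ → ℝ) : Prop :=
  ∀ t ∈ Icc 0 T, ∫ s in (0 : ℝ)..t, jumpKernel n α K t s * x s = g t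

/-- `h(t,s) = -K'_t(t,s) / K(t,t)`, where `K'_t = ∂K_i/∂t` between the curves and
`K(t,t) = Kₙ(t,t)`. -/
def resKernel (T : ℝ) (n : ℕ) (α : ℕ → ℝ → ℝ) (K : ℕ → ℝ → ℝ → ℝ) : ℝ → ℝ → ℝ :=
  jumpKernel n α fun i t s => -derivWithin (fun τ => K i τ s) (Icc 0 T) t / K n t t

/-- `f(t) = g'(t) / K(t,t)`. -/
def resRhs (T : ℝ) (n : ℕ) (K : ℕ → ℝ → ℝ → ℝ) (g : ℝ → ℝ) (t : ℝ) : ℝ :=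
  derivWithin g (Icc 0 T) t / K n t t

/-- The second-kind equation `x(t) - ∫₀ᵗ h(t,s) x(s) ds = f(t)` on `[0,T]`. -/
def SolvesSecondKind (T : ℝ) (h : ℝ → ℝ → ℝ) (f x : ℝ → ℝ) : Prop :=
  ∀ t ∈ Icc 0 T, x t - ∫ s in (0 : ℝ)..t, h t s * x s = f t

/-- The contribution `∑_{i<n} α_i'(t) (K_i - K_{i+1})(t, α_i(t)) x(α_i(t))` of the jumps of the
kernel to the derivative of `∫₀ᵗ K(t,s) x(s) ds`. -/
def jumpTerm (T : ℝ) (n : ℕ) (α : ℕ → ℝ → ℝ) (K : ℕ → ℝ → ℝ → ℝ) (x : ℝ → ℝ) (t : ℝ) : ℝ :=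
  ∑ i ∈ Finset.Ico 1 n, derivWithin (α i) (Icc 0 T) t *
    (K i t (α i t) - K (i + 1) t (α i t)) * x (α i t)

/-- The Legendre polynomial of degree `m` on `[-1,1]`, by Rodrigues' formula. -/
def legendre (m : ℕ) : ℝ[X] :=
  C ((2 ^ m * (m.factorial : ℝ))⁻¹) * derivative^[m] ((X ^ 2 - 1) ^ m)

/-- The interpolation nodes in the cell `[a,b]`: its endpoints and the roots of the Legendre
polynomial of degree `r - 2`, transported affinely from `[-1,1]`. -/
def cellNodes (r : ℕ) (a b : ℝ) : Finset ℝ :=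
  {a, b} ∪ (legendre (r - 2)).roots.toFinset.image fun y => (a + b) / 2 + (b - a) / 2 * y

/-- The grid point `t_k = kT/N`. -/
def gridPt (T : ℝ) (N k : ℕ) : ℝ := k * T / N

/-- The interpolation polynomial `P_r(u, Δ_k)` on the cell `Δ_k = [t_k, t_{k+1}]`. -/
def cellInterp (T : ℝ) (r N k : ℕ) (u : ℝ → ℝ) : ℝ[X] :=
  Lagrange.interpolate (cellNodes r (gridPt T N k) (gridPt T N (k + 1))) id u

/-- `f_k(t) = f(t) + ∑_{l<k} ∫_{t_l}^{t_{l+1}} h(t,s) y(s) ds`. -/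
def stepRhs (T : ℝ) (N k : ℕ) (h : ℝ → ℝ → ℝ) (f y : ℝ → ℝ) (t : ℝ) : ℝ :=
  f t + ∑ l ∈ Finset.range k, ∫ s in gridPt T N l..gridPt T N (l + 1), h t s * y s

/-- `y` restricted to `[0,T]` is the step-by-step spline-collocation approximation with `N` cells:
on each cell `Δ_k` it is a polynomial `p` of degree at most `r - 1` with
`p - P_r(∫_{t_k}^{·} h(·,s) p(s) ds, Δ_k) = P_r(f_k, Δ_k)`. -/
def IsCollocationSpline (T : ℝ) (r N : ℕ) (h : ℝ → ℝ → ℝ) (f y : ℝ → ℝ) : Prop :=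
  ∀ k < N, ∃ p : ℝ[X], p.degree < (r : WithBot ℕ) ∧
    (∀ t ∈ Icc (gridPt T N k) (gridPt T N (k + 1)), y t = p.eval t) ∧
    p - cellInterp T r N k (fun t => ∫ s in gridPt T N k..t, h t s * p.eval s) =
      cellInterp T r N k (stepRhs T N k h f y)

end VolterraSpline

end

open Polynomial Set

noncomputable section

namespace VolterraSpline

open MeasureTheory intervalIntegral Topology Filter

/-! Leibniz' rule on the pieces between the curves shows that the derivative of `∫₀ᵗ K(t,s) z(s) ds`
is `Kₙ(t,t) z(t)`, plus the jump term, plus the integral of `∂ₜK` against `z`. If the jump term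
vanishes, division by `Kₙ(t,t)` gives the second-kind equation; conversely, equal derivatives and
equal values at `0` give the first-kind equation (`solvesFirstKind_iff`).

The kernel `h` jumps across the curves, but it is bounded and its Volterra operator preserves
`C[0,T]`, which suffices for solvability: in a norm with weight `e^{-λt}` the operator is a
contraction (`exists_solution`). It also gains a derivative, because the discontinuities lie on
`C^r` curves (`contDiffOn_integral_resKernel`); so the solution is `C^r` by bootstrapping.

Affine invariance gives one Lebesgue constant `Λ` for all cells (`exists_lebesgue_constant`). Once
`ΛMT/N < 1`, each cell operator is injective on polynomials of degree below `r`, hence bijective,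
and the endpoint nodes glue the pieces together. For the error, the spline on a cell interpolates `x
- ∫₀ᵗ h(x - x_N)`. Comparison with a Taylor polynomial of `x` at the point of largest weighted error
leaves a Volterra term that the weight makes absorbable (`IsCollocationSpline.abs_sub_le`); no
smoothness of that term is needed.

The lower bound does not use the equation: where `x^{(r)}` stays away from zero, finite differences
keep every polynomial of degree below `r` at distance of order `N^{-r}` on an interval of length of
order `1/N` (`exists_lower_bound`). -/

/-! ### Leibniz' rule with a variable endpoint -/

lemma continuous_clamp {T : ℝ} (hT : 0 ≤ T) {F : ℝ → ℝ → ℝ}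
    (hF : ContinuousOn (fun z : ℝ × ℝ => F z.1 z.2) (Icc 0 T ×ˢ Icc 0 T)) :
    Continuous fun z : ℝ × ℝ => F (projIcc 0 T hT z.1) (projIcc 0 T hT z.2) :=
  hF.comp_continuous (f := fun z : ℝ × ℝ => ((projIcc 0 T hT z.1 : ℝ), (projIcc 0 T hT z.2 : ℝ)))
    (by fun_prop) fun z => ⟨Subtype.coe_prop _, Subtype.coe_prop _⟩

lemma projIcc_coe_of_mem {T : ℝ} (hT : 0 ≤ T) {t : ℝ} (ht : t ∈ Icc 0 T) :
    (projIcc 0 T hT t : ℝ) = t := by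
  rw [projIcc_of_mem hT ht]

lemma uIcc_zero_subset {T b : ℝ} (hb : b ∈ Icc 0 T) : uIcc 0 b ⊆ Icc 0 T := by
  rw [uIcc_of_le hb.1]
  exact Icc_subset_Icc_right hb.2

lemma uIcc_subset_of_mem {T a b : ℝ} (ha : a ∈ Icc 0 T) (hb : b ∈ Icc 0 T) :
    uIcc a b ⊆ Icc 0 T :=
  (convex_Icc 0 T).ordConnected.uIcc_subset ha hb

lemma continuousOn_integral_curve {T : ℝ} (hT : 0 ≤ T) {F : ℝ → ℝ → ℝ}
    (hF : ContinuousOn (fun z : ℝ × ℝ => F z.1 z.2) (Icc 0 T ×ˢ Icc 0 T)) {β : ℝ → ℝ}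
    (hβ : ContinuousOn β (Icc 0 T)) (hm : MapsTo β (Icc 0 T) (Icc 0 T)) :
    ContinuousOn (fun t => ∫ s in (0 : ℝ)..β t, F t s) (Icc 0 T) := by
  have h1 : Continuous fun z : ℝ × ℝ =>
      ∫ s in (0 : ℝ)..z.2, F (projIcc 0 T hT z.1) (projIcc 0 T hT s) := by
    refine continuous_parametric_intervalIntegral_of_continuous (a₀ := 0)
      (f := fun (z : ℝ × ℝ) s => F (projIcc 0 T hT z.1) (projIcc 0 T hT s)) ?_ continuous_snd
    exact (continuous_clamp hT hF).comp
      (f := fun w : (ℝ × ℝ) × ℝ => (w.1.1, w.2)) (by fun_prop)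
  have h2 := h1.comp_continuousOn (f := fun t => (t, β t)) (s := Icc 0 T)
    (continuousOn_id.prodMk hβ)
  refine h2.congr fun t ht => integral_congr fun s hs => ?_
  simp only [projIcc_coe_of_mem hT ht, projIcc_coe_of_mem hT (uIcc_zero_subset (hm ht) hs)]

/-- Leibniz' rule for `∫₀^{b} F(t,s) ds` as a function of `(t, b)`, globally on the plane. -/
lemma hasStrictFDerivAt_parametric_primitive {F k : ℝ → ℝ → ℝ}
    (hF : Continuous fun z : ℝ × ℝ => F z.1 z.2) (hk : Continuous fun z : ℝ × ℝ => k z.1 z.2)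
    {B : ℝ} (hB : ∀ t s, |k t s| ≤ B) (hd : ∀ t s, HasDerivAt (fun τ => F τ s) (k t s) t)
    (u : ℝ × ℝ) :
    HasStrictFDerivAt (fun z : ℝ × ℝ => ∫ s in (0 : ℝ)..z.2, F z.1 s)
      ((ContinuousLinearMap.toSpanSingleton ℝ (∫ s in (0 : ℝ)..u.2, k u.1 s)).coprod
        (ContinuousLinearMap.toSpanSingleton ℝ (F u.1 u.2))) u := by
  have hsec : ∀ (G : ℝ → ℝ → ℝ), Continuous (fun z : ℝ × ℝ => G z.1 z.2) → ∀ t,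
      Continuous (G t) := fun G hG t => hG.comp (f := fun s => (t, s)) (by fun_prop)
  have hcont : Continuous fun z : ℝ × ℝ => ∫ s in (0 : ℝ)..z.2, k z.1 s := by
    refine continuous_parametric_intervalIntegral_of_continuous (a₀ := 0)
      (f := fun (z : ℝ × ℝ) s => k z.1 s) ?_ continuous_snd
    exact hk.comp (f := fun w : (ℝ × ℝ) × ℝ => (w.1.1, w.2)) (by fun_prop)
  -- Continuous partial derivatives in `t` and in the endpoint imply strict differentiability in the
  -- pair.
  refine hasStrictFDerivAt_uncurry_coprod (𝕜 := ℝ) (u := u)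
    (f := fun t b => ∫ s in (0 : ℝ)..b, F t s)
    (f₁ := fun t b => ContinuousLinearMap.toSpanSingleton ℝ (∫ s in (0 : ℝ)..b, k t s))
    (f₂ := fun t b => ContinuousLinearMap.toSpanSingleton ℝ (F t b)) ?_ ?_ ?_ ?_
  · refine Eventually.of_forall fun v => ?_
    refine (intervalIntegral.hasDerivAt_integral_of_dominated_loc_of_deriv_le (F := F) (F' := k)
      (bound := fun _ => B) univ_mem ?_ ?_ ?_ ?_ ?_ ?_).2.hasFDerivAt
    · exact Eventually.of_forall fun t => (hsec F hF t).aestronglyMeasurable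
    · exact (hsec F hF _).intervalIntegrable _ _
    · exact (hsec k hk _).aestronglyMeasurable
    · exact Eventually.of_forall fun s _ t _ => hB t s
    · exact intervalIntegrable_const
    · exact Eventually.of_forall fun s _ t _ => hd t s
  · exact Eventually.of_forall fun v =>
      ((hsec F hF v.1).integral_hasStrictDerivAt 0 v.2).hasDerivAt.hasFDerivAt
  · exact ((ContinuousLinearMap.toSpanSingletonCLE (𝕜 := ℝ) (E := ℝ)).continuous.comp
      hcont).continuousAt
  · exact ((ContinuousLinearMap.toSpanSingletonCLE (𝕜 := ℝ) (E := ℝ)).continuous.comp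
      hF).continuousAt

/-- Leibniz' rule on `[0,T]` for `∫₀^{β(t)} F(t,s) ds`. -/
lemma hasDerivWithinAt_integral_curve {T : ℝ} (hT : 0 < T) {F F' : ℝ → ℝ → ℝ}
    (hF : ContinuousOn (fun z : ℝ × ℝ => F z.1 z.2) (Icc 0 T ×ˢ Icc 0 T))
    (hF' : ContinuousOn (fun z : ℝ × ℝ => F' z.1 z.2) (Icc 0 T ×ˢ Icc 0 T))
    (hd : ∀ t ∈ Icc 0 T, ∀ s ∈ Icc 0 T,
      HasDerivWithinAt (fun τ => F τ s) (F' t s) (Icc 0 T) t)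
    {β : ℝ → ℝ} (hm : MapsTo β (Icc 0 T) (Icc 0 T)) {t b' : ℝ} (ht : t ∈ Icc 0 T)
    (hβ : HasDerivWithinAt β b' (Icc 0 T) t) :
    HasDerivWithinAt (fun t => ∫ s in (0 : ℝ)..β t, F t s)
      (b' * F t (β t) + ∫ s in (0 : ℝ)..β t, F' t s) (Icc 0 T) t := by
  set π : ℝ → ℝ := fun t => projIcc 0 T hT.le t with hπ
  have hπc : Continuous π := by fun_prop
  have hπm : ∀ t, π t ∈ Icc 0 T := fun t => Subtype.coe_prop _
  have hπe : ∀ t ∈ Icc 0 T, π t = t := fun t ht => projIcc_coe_of_mem hT.le ht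
  set k : ℝ → ℝ → ℝ := fun t s => F' (π t) (π s) with hk
  have hkc : Continuous fun z : ℝ × ℝ => k z.1 z.2 := continuous_clamp hT.le hF'
  -- Clamping `F` itself would destroy differentiability at the boundary. Integrating its clamped
  -- `t`-derivative instead extends `F` from the square to the plane with a continuous, bounded
  -- `t`-derivative.
  set E : ℝ → ℝ → ℝ := fun t s => F 0 (π s) + ∫ τ in (0 : ℝ)..t, k τ s with hE
  have hEc : Continuous fun z : ℝ × ℝ => E z.1 z.2 := by
    refine Continuous.add ?_ ?_
    · have := (continuous_clamp hT.le hF).comp (f := fun z : ℝ × ℝ => ((0 : ℝ), z.2))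
        (by fun_prop)
      refine this.congr fun z => ?_
      simp [hπ]
    · refine continuous_parametric_intervalIntegral_of_continuous (a₀ := 0)
        (f := fun (z : ℝ × ℝ) τ => k τ z.2) ?_ continuous_fst
      exact hkc.comp (f := fun w : (ℝ × ℝ) × ℝ => (w.2, w.1.2)) (by fun_prop)
  have hsec : ∀ s, Continuous fun τ => k τ s := fun s =>
    hkc.comp (f := fun τ => (τ, s)) (by fun_prop)
  obtain ⟨B, hB⟩ := (isCompact_Icc.prod isCompact_Icc).exists_bound_of_continuousOn hF'
  have key := hasStrictFDerivAt_parametric_primitive hEc hkc (B := B)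
    (fun t s => hB (π t, π s) ⟨hπm t, hπm s⟩)
    (fun t s => (((hsec s).integral_hasStrictDerivAt 0 t).hasDerivAt).const_add _) (t, β t)
  have hEF : ∀ t ∈ Icc 0 T, ∀ s ∈ Icc 0 T, E t s = F t s := by
    intro t ht s hs
    have h1 : ∫ τ in (0 : ℝ)..t, k τ s = F t s - F 0 s := by
      rw [← integral_eq_sub_of_hasDeriv_right_of_le ht.1 (f := fun τ => F τ s)
        (f' := fun τ => k τ s)]
      · exact fun τ hτ => ((hd τ ⟨hτ.1, hτ.2.trans ht.2⟩ s hs).continuousWithinAt).mono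
          (Icc_subset_Icc_right ht.2)
      · intro τ hτ
        have hτ' : τ ∈ Icc 0 T := ⟨hτ.1.le, hτ.2.le.trans ht.2⟩
        simp only [hk, hπe τ hτ', hπe s hs]
        exact ((hd τ hτ' s hs).hasDerivAt
          (Icc_mem_nhds hτ.1 (hτ.2.trans_le ht.2))).hasDerivWithinAt
      · exact (hsec s).intervalIntegrable _ _
    simp only [hE, h1, hπe s hs]
    ring
  have h2 := key.hasFDerivAt.comp_hasDerivWithinAt (f := fun t => (t, β t)) (s := Icc 0 T) t
    ((hasDerivWithinAt_id t _).prodMk hβ)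
  have h3 : HasDerivWithinAt (fun t => ∫ s in (0 : ℝ)..β t, E t s)
      (b' * E t (β t) + ∫ s in (0 : ℝ)..β t, k t s) (Icc 0 T) t := by
    refine HasDerivWithinAt.congr_deriv (f := fun t => ∫ s in (0 : ℝ)..β t, E t s) h2 ?_
    simp [add_comm]
  have h4 : ∫ s in (0 : ℝ)..β t, k t s = ∫ s in (0 : ℝ)..β t, F' t s :=
    integral_congr fun s hs => by
      simp only [hk, hπe t ht, hπe s (uIcc_zero_subset (hm ht) hs)]
  rw [hEF t ht _ (hm ht), h4] at h3
  refine h3.congr (fun τ hτ => ?_) ?_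
  · exact integral_congr fun s hs => (hEF τ hτ s (uIcc_zero_subset (hm hτ) hs)).symm
  · exact integral_congr fun s hs => (hEF t ht s (uIcc_zero_subset (hm ht) hs)).symm

lemma contDiffOn_succ_of_hasDerivWithinAt {T : ℝ} (hT : 0 < T) {k : ℕ} {f f' : ℝ → ℝ}
    (hd : ∀ t ∈ Icc 0 T, HasDerivWithinAt f (f' t) (Icc 0 T) t)
    (hf' : ContDiffOn ℝ k f' (Icc 0 T)) : ContDiffOn ℝ (k + 1 : ℕ) f (Icc 0 T) := by
  push_cast
  rw [contDiffOn_succ_iff_derivWithin (uniqueDiffOn_Icc hT)]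
  refine ⟨fun t ht => (hd t ht).differentiableWithinAt, by simp, ?_⟩
  exact hf'.congr fun t ht => (hd t ht).derivWithin (uniqueDiffOn_Icc hT t ht)

lemma contDiffOn_derivWithin_Icc {T : ℝ} (hT : 0 < T) {k : ℕ} {f : ℝ → ℝ}
    (hf : ContDiffOn ℝ (k + 1 : ℕ) f (Icc 0 T)) :
    (∀ t ∈ Icc 0 T, HasDerivWithinAt f (derivWithin f (Icc 0 T) t) (Icc 0 T) t) ∧
      ContDiffOn ℝ k (derivWithin f (Icc 0 T)) (Icc 0 T) := by
  push_cast at hf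
  rw [contDiffOn_succ_iff_derivWithin (uniqueDiffOn_Icc hT)] at hf
  exact ⟨fun t ht => (hf.1 t ht).hasDerivWithinAt, hf.2.2⟩

/-! ### Mixed smoothness classes along curves -/

namespace MixedC

variable {T : ℝ} {p q : ℕ} {F : ℝ → ℝ → ℝ}

lemma mono {p' q' : ℕ} (h : MixedC T p q F) (hp : p' ≤ p) (hq : q' ≤ q) : MixedC T p' q' F := by
  obtain ⟨D, h0, hc, h1, h2⟩ := h
  exact ⟨D, h0, fun a ha b hb => hc a (ha.trans hp) b (hb.trans hq),
    fun a ha b hb => h1 a (ha.trans_le hp) b (hb.trans hq),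
    fun a ha b hb => h2 a (ha.trans hp) b (hb.trans_le hq)⟩

lemma continuousOn (h : MixedC T p q F) :
    ContinuousOn (fun z : ℝ × ℝ => F z.1 z.2) (Icc 0 T ×ˢ Icc 0 T) := by
  obtain ⟨D, h0, hc, -, -⟩ := h
  exact (hc 0 (Nat.zero_le _) 0 (Nat.zero_le _)).congr fun z hz => (h0 _ hz.1 _ hz.2).symm

lemma exists_deriv_fst (h : MixedC T (p + 1) q F) : ∃ F' : ℝ → ℝ → ℝ, MixedC T p q F' ∧
    ∀ t ∈ Icc 0 T, ∀ s ∈ Icc 0 T, HasDerivWithinAt (fun τ => F τ s) (F' t s) (Icc 0 T) t := by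
  obtain ⟨D, h0, hc, h1, h2⟩ := h
  refine ⟨D 1 0, ⟨fun a b => D (a + 1) b, fun _ _ _ _ => rfl,
    fun a ha b hb => hc _ (by omega) b hb, fun a ha b hb => h1 _ (by omega) b hb,
    fun a ha b hb => h2 _ (by omega) b hb⟩, fun t ht s hs => ?_⟩
  exact (h1 0 (by omega) 0 (by omega) t ht s hs).congr (fun τ hτ => (h0 τ hτ s hs).symm)
    (h0 t ht s hs).symm

end MixedC

lemma ContinuousOn.section_snd {T : ℝ} {F : ℝ → ℝ → ℝ}
    (hF : ContinuousOn (fun z : ℝ × ℝ => F z.1 z.2) (Icc 0 T ×ˢ Icc 0 T)) {t : ℝ}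
    (ht : t ∈ Icc 0 T) : ContinuousOn (F t) (Icc 0 T) :=
  hF.comp (f := fun s => (t, s)) (by fun_prop) fun _ hs => ⟨ht, hs⟩

lemma ContinuousOn.comp_curve {T : ℝ} {F : ℝ → ℝ → ℝ}
    (hF : ContinuousOn (fun z : ℝ × ℝ => F z.1 z.2) (Icc 0 T ×ˢ Icc 0 T)) {β : ℝ → ℝ}
    (hβ : ContinuousOn β (Icc 0 T)) (hm : MapsTo β (Icc 0 T) (Icc 0 T)) :
    ContinuousOn (fun t => F t (β t)) (Icc 0 T) :=
  hF.comp (f := fun t => (t, β t)) (continuousOn_id.prodMk hβ) fun _ ht => ⟨ht, hm ht⟩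

/-- The chain rule for `F(t, β(t))` on `[0,T]`. -/
lemma exists_hasDerivWithinAt_comp_curve {T : ℝ} (hT : 0 < T) {k : ℕ} {F : ℝ → ℝ → ℝ}
    (hF : MixedC T (k + 1) (k + 1) F) {β : ℝ → ℝ} (hm : MapsTo β (Icc 0 T) (Icc 0 T))
    (hβ : DifferentiableOn ℝ β (Icc 0 T)) :
    ∃ F₁ F₂ : ℝ → ℝ → ℝ, MixedC T k k F₁ ∧ MixedC T k k F₂ ∧ ∀ t ∈ Icc 0 T,
      HasDerivWithinAt (fun t => F t (β t))
        (F₁ t (β t) + derivWithin β (Icc 0 T) t * F₂ t (β t)) (Icc 0 T) t := by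
  obtain ⟨D, h0, hc, h1, h2⟩ := hF
  refine ⟨D 1 0, D 0 1, ⟨fun a b => D (a + 1) b, fun _ _ _ _ => rfl,
    fun a ha b hb => hc _ (by omega) b (by omega),
    fun a ha b hb => h1 _ (by omega) b (by omega),
    fun a ha b hb => h2 _ (by omega) b (by omega)⟩,
    ⟨fun a b => D a (b + 1), fun _ _ _ _ => rfl,
    fun a ha b hb => hc a (by omega) _ (by omega), fun a ha b hb => h1 a (by omega) _ (by omega),
    fun a ha b hb => h2 a (by omega) _ (by omega)⟩, ?_⟩
  have hz : (0 : ℝ) ∈ Icc 0 T := ⟨le_rfl, hT.le⟩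
  -- The chain rule follows from Leibniz' rule applied to `F(t,β(t)) = F(t,0) + ∫₀^{β(t)} ∂ₛF(t,s)
  -- ds`.
  have ftc : ∀ a ≤ k + 1, ∀ t ∈ Icc 0 T, ∀ b ∈ Icc 0 T,
      ∫ s in (0 : ℝ)..b, D a 1 t s = D a 0 t b - D a 0 t 0 := by
    intro a ha t ht b hb
    refine integral_eq_sub_of_hasDeriv_right_of_le hb.1 (f := fun σ => D a 0 t σ) ?_ ?_ ?_
    · exact fun σ hσ => ((h2 a ha 0 (by omega) t ht σ
        ⟨hσ.1, hσ.2.trans hb.2⟩).continuousWithinAt).mono (Icc_subset_Icc_right hb.2)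
    · exact fun σ hσ => ((h2 a ha 0 (by omega) t ht σ ⟨hσ.1.le, hσ.2.le.trans hb.2⟩).hasDerivAt
        (Icc_mem_nhds hσ.1 (hσ.2.trans_le hb.2))).hasDerivWithinAt
    · exact ((ContinuousOn.section_snd (hc a ha 1 (by omega)) ht).mono
        (uIcc_zero_subset hb)).intervalIntegrable
  intro t ht
  have h3 := hasDerivWithinAt_integral_curve hT (hc 0 (by omega) 1 (by omega))
    (hc 1 (by omega) 1 (by omega)) (fun t ht s hs => h1 0 (by omega) 1 (by omega) t ht s hs) hm ht
    (hβ t ht).hasDerivWithinAt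
  rw [ftc 1 (by omega) t ht _ (hm ht)] at h3
  have h4 := (h1 0 (by omega) 0 (by omega) t ht 0 hz).add h3
  have h5 : HasDerivWithinAt (fun t => F t (β t)) (D (0 + 1) 0 t 0 +
      (derivWithin β (Icc 0 T) t * D 0 1 t (β t) + (D 1 0 t (β t) - D 1 0 t 0))) (Icc 0 T) t := by
    refine h4.congr_of_mem (fun τ hτ => ?_) ht
    simp only [Pi.add_apply]
    rw [ftc 0 (by omega) τ hτ _ (hm hτ), ← h0 τ hτ _ (hm hτ)]
    ring
  convert h5 using 1
  ring_nf

lemma contDiffOn_comp_curve {T : ℝ} (hT : 0 < T) {k : ℕ} {F : ℝ → ℝ → ℝ} (hF : MixedC T k k F)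
    {β : ℝ → ℝ} (hβ : ContDiffOn ℝ k β (Icc 0 T)) (hm : MapsTo β (Icc 0 T) (Icc 0 T)) :
    ContDiffOn ℝ k (fun t => F t (β t)) (Icc 0 T) := by
  induction k generalizing F with
  | zero =>
    simp only [CharP.cast_eq_zero, contDiffOn_zero] at hβ ⊢
    exact ContinuousOn.comp_curve hF.continuousOn hβ hm
  | succ k ih =>
    have hβ' := contDiffOn_derivWithin_Icc hT hβ
    have hβk : ContDiffOn ℝ k β (Icc 0 T) := hβ.of_le (by exact_mod_cast Nat.le_succ k)
    obtain ⟨F₁, F₂, hF₁, hF₂, hd⟩ := exists_hasDerivWithinAt_comp_curve hT hF hm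
      fun t ht => (hβ'.1 t ht).differentiableWithinAt
    exact contDiffOn_succ_of_hasDerivWithinAt hT hd
      ((ih hF₁ hβk).add (hβ'.2.mul (ih hF₂ hβk)))

/-- Leibniz' rule for `∫₀^{β(t)} F(t,s) u(s) ds`. -/
lemma hasDerivWithinAt_integral_curve_mul {T : ℝ} (hT : 0 < T) {F F' : ℝ → ℝ → ℝ}
    (hF : ContinuousOn (fun z : ℝ × ℝ => F z.1 z.2) (Icc 0 T ×ˢ Icc 0 T))
    (hF' : ContinuousOn (fun z : ℝ × ℝ => F' z.1 z.2) (Icc 0 T ×ˢ Icc 0 T))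
    (hd : ∀ t ∈ Icc 0 T, ∀ s ∈ Icc 0 T,
      HasDerivWithinAt (fun τ => F τ s) (F' t s) (Icc 0 T) t)
    {u : ℝ → ℝ} (hu : ContinuousOn u (Icc 0 T))
    {β : ℝ → ℝ} (hm : MapsTo β (Icc 0 T) (Icc 0 T)) {t b' : ℝ} (ht : t ∈ Icc 0 T)
    (hβ : HasDerivWithinAt β b' (Icc 0 T) t) :
    HasDerivWithinAt (fun t => ∫ s in (0 : ℝ)..β t, F t s * u s)
      (b' * (F t (β t) * u (β t)) + ∫ s in (0 : ℝ)..β t, F' t s * u s) (Icc 0 T) t := by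
  have hu2 : ContinuousOn (fun z : ℝ × ℝ => u z.2) (Icc 0 T ×ˢ Icc 0 T) :=
    hu.comp continuousOn_snd fun z hz => hz.2
  exact hasDerivWithinAt_integral_curve hT (F := fun t s => F t s * u s)
    (F' := fun t s => F' t s * u s) (hF.mul hu2) (hF'.mul hu2)
    (fun t ht s hs => (hd t ht s hs).mul_const _) hm ht hβ

lemma continuousOn_integral_curve_mul {T : ℝ} (hT : 0 ≤ T) {F : ℝ → ℝ → ℝ}
    (hF : ContinuousOn (fun z : ℝ × ℝ => F z.1 z.2) (Icc 0 T ×ˢ Icc 0 T)) {u : ℝ → ℝ}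
    (hu : ContinuousOn u (Icc 0 T)) {β : ℝ → ℝ}
    (hβ : ContinuousOn β (Icc 0 T)) (hm : MapsTo β (Icc 0 T) (Icc 0 T)) :
    ContinuousOn (fun t => ∫ s in (0 : ℝ)..β t, F t s * u s) (Icc 0 T) :=
  continuousOn_integral_curve hT (F := fun t s => F t s * u s)
    (hF.mul (hu.comp continuousOn_snd fun _ hz => hz.2)) hβ hm

/-- Differentiation never falls on `u`: it yields the boundary term `β'(t) F(t,β(t)) u(β(t))` and an
integral of the same type. So `u` may have one derivative fewer than the result; for `k = 0` the
truncated `k - 1` asks only for continuity. -/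
lemma contDiffOn_integral_curve_mul {T : ℝ} (hT : 0 < T) {k : ℕ} {F : ℝ → ℝ → ℝ}
    (hF : MixedC T k k F) {β : ℝ → ℝ} (hβ : ContDiffOn ℝ k β (Icc 0 T))
    (hm : MapsTo β (Icc 0 T) (Icc 0 T)) {u : ℝ → ℝ}
    (hu : ContDiffOn ℝ (k - 1 : ℕ) u (Icc 0 T)) :
    ContDiffOn ℝ k (fun t => ∫ s in (0 : ℝ)..β t, F t s * u s) (Icc 0 T) := by
  induction k generalizing F with
  | zero =>
    simp only [CharP.cast_eq_zero, contDiffOn_zero] at hβ ⊢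
    exact continuousOn_integral_curve_mul hT.le hF.continuousOn hu.continuousOn hβ hm
  | succ k ih =>
    have hβ' := contDiffOn_derivWithin_Icc hT hβ
    have hβk : ContDiffOn ℝ k β (Icc 0 T) := hβ.of_le (by exact_mod_cast Nat.le_succ k)
    have huk : ContDiffOn ℝ k u (Icc 0 T) := hu
    obtain ⟨F', hF', hd⟩ := hF.exists_deriv_fst
    refine contDiffOn_succ_of_hasDerivWithinAt hT (fun t ht =>
      hasDerivWithinAt_integral_curve_mul hT hF.continuousOn hF'.continuousOn hd
        hu.continuousOn hm ht (hβ'.1 t ht)) (ContDiffOn.add ?_ ?_)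
    · exact hβ'.2.mul ((contDiffOn_comp_curve hT (hF.mono k.le_succ k.le_succ) hβk hm).mul
        (huk.comp hβk hm))
    · exact ih (hF'.mono le_rfl k.le_succ) hβk
        (hu.of_le (by exact_mod_cast (by omega : k - 1 ≤ k + 1 - 1)))

/-! ### Volterra kernels, curves and piecewise kernels -/

/-- A bounded kernel with measurable sections whose Volterra operator preserves `C[0,T]`. -/
structure IsVolterraKernel (T M : ℝ) (h : ℝ → ℝ → ℝ) : Prop where
  nonneg : 0 ≤ M
  bound : ∀ t ∈ Icc 0 T, ∀ s ∈ Icc 0 T, |h t s| ≤ M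
  meas : ∀ t ∈ Icc 0 T, AEStronglyMeasurable (h t) (volume.restrict (Icc 0 T))
  continuousOn : ∀ u : ℝ → ℝ, ContinuousOn u (Icc 0 T) →
    ContinuousOn (fun t => ∫ s in (0 : ℝ)..t, h t s * u s) (Icc 0 T)

namespace CurveSystem

variable {T : ℝ} {r n : ℕ} {α : ℕ → ℝ → ℝ}

lemma le_of_le (hα : CurveSystem T r n α) {t : ℝ} (ht : t ∈ Icc 0 T) {i j : ℕ} (hij : i ≤ j)
    (hj : j ≤ n) : α i t ≤ α j t := by
  induction j, hij using Nat.le_induction with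
  | base => exact le_rfl
  | succ j hij ih =>
    refine (ih (by omega)).trans ?_
    rcases ht.1.eq_or_lt with h0 | h0
    · rw [← h0, hα.at_zero j (by omega), hα.at_zero (j + 1) hj]
    · exact (hα.lt j (by omega) t ⟨h0, ht.2⟩).le

lemma mem_Icc (hα : CurveSystem T r n α) {t : ℝ} (ht : t ∈ Icc 0 T) {i : ℕ} (hi : i ≤ n) :
    α i t ∈ Icc 0 t := by
  have h0 := hα.le_of_le ht (Nat.zero_le i) hi
  have h1 := hα.le_of_le ht hi le_rfl
  rw [hα.first t ht] at h0
  rw [hα.last t ht] at h1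
  exact ⟨h0, h1⟩

lemma mapsTo (hα : CurveSystem T r n α) {i : ℕ} (hi : i ≤ n) :
    MapsTo (α i) (Icc 0 T) (Icc 0 T) :=
  fun _ ht => Icc_subset_Icc_right ht.2 (hα.mem_Icc ht hi)

end CurveSystem

section JumpKernel

variable {T : ℝ} {r n : ℕ} {α : ℕ → ℝ → ℝ} {F : ℕ → ℝ → ℝ → ℝ}

lemma jumpKernel_eq_sum_indicator (t : ℝ) :
    jumpKernel n α F t = fun s => ∑ i ∈ Finset.Icc 1 n,
      (Ioo (α (i - 1) t) (α i t)).indicator (F i t) s := by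
  funext s
  simp only [jumpKernel, indicator, mem_Ioo]

lemma integrableOn_jumpKernel_mul {t : ℝ}
    (hF : ∀ i, 1 ≤ i → i ≤ n → ContinuousOn (F i t) (Icc 0 T)) {u : ℝ → ℝ}
    (hu : ContinuousOn u (Icc 0 T)) :
    ∀ i ∈ Finset.Icc 1 n, IntegrableOn
      (fun s => (Ioo (α (i - 1) t) (α i t)).indicator (F i t) s * u s) (Icc 0 T) := by
  intro i hi
  rw [Finset.mem_Icc] at hi
  have h1 := (((hF i hi.1 hi.2).mul hu).integrableOn_Icc (μ := volume)).indicator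
    (t := Ioo (α (i - 1) t) (α i t)) measurableSet_Ioo
  refine h1.congr_fun (fun s _ => ?_) measurableSet_Icc
  simp only [indicator]
  split_ifs <;> simp

/-- Each `F i` lives on the whole square, so its integral between two curves is a difference of
integrals from `0`. This leaves one moving endpoint at a time for Leibniz' rule. -/
lemma integral_jumpKernel_mul (hα : CurveSystem T r n α) {t : ℝ} (ht : t ∈ Icc 0 T)
    (hF : ∀ i, 1 ≤ i → i ≤ n → ContinuousOn (F i t) (Icc 0 T)) {u : ℝ → ℝ}
    (hu : ContinuousOn u (Icc 0 T)) :
    ∫ s in (0 : ℝ)..t, jumpKernel n α F t s * u s =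
      ∑ i ∈ Finset.Icc 1 n, ((∫ s in (0 : ℝ)..α i t, F i t s * u s) -
        ∫ s in (0 : ℝ)..α (i - 1) t, F i t s * u s) := by
  have hint := integrableOn_jumpKernel_mul (α := α) hF hu
  simp_rw [jumpKernel_eq_sum_indicator, Finset.sum_mul]
  rw [intervalIntegral.integral_finsetSum]
  · refine Finset.sum_congr rfl fun i hi => ?_
    rw [Finset.mem_Icc] at hi
    have h0 := hα.mem_Icc ht (i := i - 1) (by omega)
    have h1 := hα.mem_Icc ht hi.2
    have h01 := hα.le_of_le ht (Nat.sub_le i 1) hi.2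
    have hI : ∀ b ∈ Icc 0 t, IntervalIntegrable (fun s => F i t s * u s) volume 0 b :=
      fun b hb => (((hF i hi.1 hi.2).mul hu).mono
        (uIcc_zero_subset ⟨hb.1, hb.2.trans ht.2⟩)).intervalIntegrable
    rw [integral_interval_sub_left (hI _ h1) (hI _ h0), integral_of_le h01, integral_of_le ht.1,
      integral_Ioc_eq_integral_Ioo (x := α (i - 1) t)]
    have h2 : (fun s => (Ioo (α (i - 1) t) (α i t)).indicator (F i t) s * u s) =
        (Ioo (α (i - 1) t) (α i t)).indicator fun s => F i t s * u s := by
      funext s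
      simp only [indicator]
      split_ifs <;> simp
    rw [h2, setIntegral_indicator measurableSet_Ioo, inter_eq_right.mpr]
    exact fun s hs => ⟨h0.1.trans_lt hs.1, hs.2.le.trans h1.2⟩
  · intro i hi
    rw [intervalIntegrable_iff_integrableOn_Icc_of_le ht.1]
    exact (hint i hi).mono_set (Icc_subset_Icc_right ht.2)

lemma aestronglyMeasurable_jumpKernel {t : ℝ}
    (hF : ∀ i, 1 ≤ i → i ≤ n → ContinuousOn (F i t) (Icc 0 T)) :
    AEStronglyMeasurable (jumpKernel n α F t) (volume.restrict (Icc 0 T)) := by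
  rw [jumpKernel_eq_sum_indicator]
  refine Finset.aestronglyMeasurable_fun_sum _ fun i hi => ?_
  rw [Finset.mem_Icc] at hi
  exact ((hF i hi.1 hi.2).integrableOn_Icc.indicator measurableSet_Ioo).aestronglyMeasurable

lemma exists_bound_jumpKernel
    (hF : ∀ i, 1 ≤ i → i ≤ n →
      ContinuousOn (fun z : ℝ × ℝ => F i z.1 z.2) (Icc 0 T ×ˢ Icc 0 T)) :
    ∃ M, 0 ≤ M ∧ ∀ t ∈ Icc 0 T, ∀ s ∈ Icc 0 T, |jumpKernel n α F t s| ≤ M := by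
  have hB : ∀ i, ∃ B : ℝ, 1 ≤ i → i ≤ n → ∀ t ∈ Icc 0 T, ∀ s ∈ Icc 0 T, |F i t s| ≤ B := by
    intro i
    by_cases hi : 1 ≤ i ∧ i ≤ n
    · obtain ⟨B, hB⟩ := (isCompact_Icc.prod isCompact_Icc).exists_bound_of_continuousOn
        (hF i hi.1 hi.2)
      exact ⟨B, fun _ _ t ht s hs => hB (t, s) ⟨ht, hs⟩⟩
    · exact ⟨0, fun h1 h2 => (hi ⟨h1, h2⟩).elim⟩
  choose B hB using hB
  refine ⟨∑ i ∈ Finset.Icc 1 n, |B i|, Finset.sum_nonneg fun i _ => abs_nonneg _,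
    fun t ht s hs => (Finset.abs_sum_le_sum_abs _ _).trans (Finset.sum_le_sum fun i hi => ?_)⟩
  rw [Finset.mem_Icc] at hi
  split_ifs
  · exact (hB i hi.1 hi.2 t ht s hs).trans (le_abs_self _)
  · simp

/-- The upper boundary of piece `i` and the lower boundary of piece `i + 1` are the same curve.
Pairing them turns the Leibniz boundary terms into the jumps `K_i - K_{i+1}`. -/
lemma sum_Icc_sub_eq {a b : ℕ → ℝ} (hn : 1 ≤ n) :
    ∑ i ∈ Finset.Icc 1 n, (a i - b i) = a n - b 1 + ∑ i ∈ Finset.Ico 1 n, (a i - b (i + 1)) := by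
  induction n, hn using Nat.le_induction with
  | base => simp
  | succ n hn ih =>
    rw [Finset.sum_Icc_succ_top (by omega), ih, Finset.sum_Ico_succ_top hn]
    ring

end JumpKernel

/-! ### The resolvent kernel and the equivalence of the two equations -/

section ResKernel

variable {T : ℝ} {r n : ℕ} {α : ℕ → ℝ → ℝ} {K : ℕ → ℝ → ℝ → ℝ}

/-- The partial derivative in the first variable on the square `[0,T]²`. -/
def partialFst (T : ℝ) (F : ℝ → ℝ → ℝ) (t s : ℝ) : ℝ :=
  derivWithin (fun τ => F τ s) (Icc 0 T) t

lemma MixedC.partialFst (hT : 0 < T) {p q : ℕ} {F : ℝ → ℝ → ℝ} (h : MixedC T (p + 1) q F) :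
    MixedC T p q (partialFst T F) ∧ ∀ t ∈ Icc 0 T, ∀ s ∈ Icc 0 T,
      HasDerivWithinAt (fun τ => F τ s) (VolterraSpline.partialFst T F t s) (Icc 0 T) t := by
  obtain ⟨F', ⟨D, h0, hD⟩, hd⟩ := h.exists_deriv_fst
  have he : ∀ t ∈ Icc 0 T, ∀ s ∈ Icc 0 T, VolterraSpline.partialFst T F t s = F' t s :=
    fun t ht s hs => (hd t ht s hs).derivWithin (uniqueDiffOn_Icc hT t ht)
  refine ⟨⟨D, fun t ht s hs => (h0 t ht s hs).trans (he t ht s hs).symm, hD⟩, ?_⟩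
  intro t ht s hs
  rw [he t ht s hs]
  exact hd t ht s hs

/-- The diagonal factor depends on `t` alone, so it leaves the integral and its regularity is
treated separately. -/
lemma resKernel_eq (t s : ℝ) : resKernel T n α K t s =
    -(K n t t)⁻¹ * jumpKernel n α (fun i => partialFst T (K i)) t s := by
  simp only [resKernel, jumpKernel, partialFst, Finset.mul_sum]
  refine Finset.sum_congr rfl fun i _ => ?_
  split_ifs
  · ring
  · simp

lemma integral_resKernel_mul (a b t : ℝ) (u : ℝ → ℝ) :
    ∫ s in a..b, resKernel T n α K t s * u s =
      -(K n t t)⁻¹ * ∫ s in a..b, jumpKernel n α (fun i => partialFst T (K i)) t s * u s := by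
  simp_rw [resKernel_eq, mul_assoc]
  rw [intervalIntegral.integral_const_mul]

variable (hT : 0 < T) (hn : 1 ≤ n) (hα : CurveSystem T r n α)
  (hK : ∀ i, 1 ≤ i → i ≤ n → MixedC T (r + 1) r (K i)) (hdiag : ∀ t ∈ Icc 0 T, K n t t ≠ 0)

include hT hK

lemma contDiffOn_diag (hn : 1 ≤ n) : ContDiffOn ℝ r (fun t => K n t t) (Icc 0 T) :=
  contDiffOn_comp_curve hT ((hK n hn le_rfl).mono r.le_succ le_rfl) (β := fun t => t)
    contDiffOn_id fun _ h => h

include hα hn hdiag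

/-- The Volterra operator with kernel `resKernel` gains one derivative. -/
lemma contDiffOn_integral_resKernel {k : ℕ} (hk : k ≤ r) {u : ℝ → ℝ}
    (hu : ContDiffOn ℝ (k - 1 : ℕ) u (Icc 0 T)) :
    ContDiffOn ℝ k (fun t => ∫ s in (0 : ℝ)..t, resKernel T n α K t s * u s) (Icc 0 T) := by
  simp_rw [integral_resKernel_mul]
  have hkr : ((k : ℕ) : WithTop ℕ∞) ≤ r := by exact_mod_cast hk
  refine ContDiffOn.mul ?_ ?_
  · exact ((contDiffOn_diag hT hK hn).inv hdiag).neg.of_le hkr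
  · have h1 : ∀ i, 1 ≤ i → i ≤ n → MixedC T k k (partialFst T (K i)) := fun i hi hi' =>
      (MixedC.partialFst hT (hK i hi hi')).1.mono hk hk
    refine ContDiffOn.congr (f := fun t => ∑ i ∈ Finset.Icc 1 n,
      ((∫ s in (0 : ℝ)..α i t, partialFst T (K i) t s * u s) -
        ∫ s in (0 : ℝ)..α (i - 1) t, partialFst T (K i) t s * u s)) ?_ ?_
    · refine ContDiffOn.sum fun i hi => ?_
      rw [Finset.mem_Icc] at hi
      refine ContDiffOn.sub ?_ ?_
      · exact contDiffOn_integral_curve_mul hT (h1 i hi.1 hi.2)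
          ((hα.smooth i hi.2).of_le hkr) (hα.mapsTo hi.2) hu
      · exact contDiffOn_integral_curve_mul hT (h1 i hi.1 hi.2)
          ((hα.smooth (i - 1) (by omega)).of_le hkr) (hα.mapsTo (by omega)) hu
    · exact fun t ht => integral_jumpKernel_mul hα ht
        (fun i hi hi' => ContinuousOn.section_snd (h1 i hi hi').continuousOn ht) hu.continuousOn

lemma exists_isVolterraKernel_resKernel : ∃ M, IsVolterraKernel T M (resKernel T n α K) := by
  have hc : ∀ i, 1 ≤ i → i ≤ n → ContinuousOn
      (fun z : ℝ × ℝ => partialFst T (K i) z.1 z.2) (Icc 0 T ×ˢ Icc 0 T) := fun i hi hi' =>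
    (MixedC.partialFst hT (hK i hi hi')).1.continuousOn
  obtain ⟨M, hM0, hM⟩ := exists_bound_jumpKernel (α := α) hc
  have hinv : ContinuousOn (fun t => (K n t t)⁻¹) (Icc 0 T) :=
    (contDiffOn_diag hT hK hn).continuousOn.inv₀ hdiag
  obtain ⟨B, hB⟩ := isCompact_Icc.exists_bound_of_continuousOn hinv
  have hB0 : 0 ≤ B := (norm_nonneg _).trans (hB 0 ⟨le_rfl, hT.le⟩)
  refine ⟨B * M, mul_nonneg hB0 hM0, fun t ht s hs => ?_, fun t ht => ?_, fun u hu => ?_⟩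
  · rw [resKernel_eq, abs_mul, abs_neg]
    exact mul_le_mul (hB t ht) (hM t ht s hs) (abs_nonneg _) hB0
  · simp_rw [funext (resKernel_eq (T := T) (n := n) (α := α) (K := K) t)]
    exact (aestronglyMeasurable_jumpKernel fun i hi hi' =>
      ContinuousOn.section_snd (hc i hi hi') ht).const_mul _
  -- The case `k = 0` of the smoothing property, where `u` need only be continuous.
  · have := contDiffOn_integral_resKernel hT hn hα hK hdiag (Nat.zero_le r) (u := u)
      (by simpa using hu)
    exact this.continuousOn

omit hdiag

/-- The derivative of the left-hand side of the first-kind equation. -/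
lemma hasDerivWithinAt_firstKind (hr : 1 ≤ r) {z : ℝ → ℝ} (hz : ContinuousOn z (Icc 0 T)) {t : ℝ}
    (ht : t ∈ Icc 0 T) :
    HasDerivWithinAt (fun t => ∫ s in (0 : ℝ)..t, jumpKernel n α K t s * z s)
      (K n t t * z t + jumpTerm T n α K z t +
        ∫ s in (0 : ℝ)..t, jumpKernel n α (fun i => partialFst T (K i)) t s * z s)
      (Icc 0 T) t := by
  have hp : ∀ i, 1 ≤ i → i ≤ n → _ := fun i hi hi' => MixedC.partialFst hT (hK i hi hi')
  have hd : ∀ i ≤ n, HasDerivWithinAt (α i) (derivWithin (α i) (Icc 0 T) t) (Icc 0 T) t :=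
    fun i hi => ((hα.smooth i hi).differentiableOn
      (by exact_mod_cast (by omega : r ≠ 0)) t ht).hasDerivWithinAt
  have h1 : HasDerivWithinAt (fun t => ∑ i ∈ Finset.Icc 1 n,
      ((∫ s in (0 : ℝ)..α i t, K i t s * z s) - ∫ s in (0 : ℝ)..α (i - 1) t, K i t s * z s))
      (∑ i ∈ Finset.Icc 1 n,
        ((derivWithin (α i) (Icc 0 T) t * (K i t (α i t) * z (α i t)) +
          ∫ s in (0 : ℝ)..α i t, partialFst T (K i) t s * z s) -
        (derivWithin (α (i - 1)) (Icc 0 T) t * (K i t (α (i - 1) t) * z (α (i - 1) t)) +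
          ∫ s in (0 : ℝ)..α (i - 1) t, partialFst T (K i) t s * z s))) (Icc 0 T) t := by
    refine HasDerivWithinAt.fun_sum fun i hi => ?_
    rw [Finset.mem_Icc] at hi
    refine HasDerivWithinAt.fun_sub ?_ ?_
    · exact hasDerivWithinAt_integral_curve_mul hT (hK i hi.1 hi.2).continuousOn
        (hp i hi.1 hi.2).1.continuousOn (hp i hi.1 hi.2).2 hz (hα.mapsTo hi.2) ht (hd i hi.2)
    · exact hasDerivWithinAt_integral_curve_mul hT (hK i hi.1 hi.2).continuousOn
        (hp i hi.1 hi.2).1.continuousOn (hp i hi.1 hi.2).2 hz (hα.mapsTo (by omega)) ht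
        (hd (i - 1) (by omega))
  have h2 := h1.congr_of_mem (f₁ := fun t => ∫ s in (0 : ℝ)..t, jumpKernel n α K t s * z s)
    (fun τ hτ => integral_jumpKernel_mul hα hτ (fun i hi hi' =>
      ContinuousOn.section_snd (hK i hi hi').continuousOn hτ) hz) ht
  refine h2.congr_deriv ?_
  rw [integral_jumpKernel_mul hα ht (fun i hi hi' =>
    ContinuousOn.section_snd (hp i hi hi').1.continuousOn ht) hz]
  simp_rw [add_sub_add_comm]
  rw [Finset.sum_add_distrib, sum_Icc_sub_eq (n := n)
    (a := fun i => derivWithin (α i) (Icc 0 T) t * (K i t (α i t) * z (α i t)))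
    (b := fun i => derivWithin (α (i - 1)) (Icc 0 T) t *
      (K i t (α (i - 1) t) * z (α (i - 1) t))) hn]
  -- The outermost curves have slopes `1` and `0`: the diagonal contributes `Kₙ(t,t) z(t)` and the
  -- axis `s = 0` nothing.
  have hn1 : derivWithin (α n) (Icc 0 T) t = 1 := by
    rw [derivWithin_congr (f := fun t => t) hα.last (hα.last t ht)]
    exact derivWithin_id' t _ (uniqueDiffOn_Icc hT t ht)
  have h01 : derivWithin (α 0) (Icc 0 T) t = 0 := by
    rw [derivWithin_congr (f := fun _ => (0 : ℝ)) hα.first (hα.first t ht)]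
    simp
  simp only [hn1, Nat.sub_self, h01, hα.last t ht, jumpTerm, Nat.add_sub_cancel]
  congr 1
  rw [one_mul, zero_mul, sub_zero]
  congr 1
  exact Finset.sum_congr rfl fun i _ => by ring

include hdiag

/-- When the jump term vanishes, the derivative of the first-kind defect is `Kₙ(t,t)` times the
second-kind defect. The first-kind defect is zero at `t = 0` because `g 0 = 0`, so it vanishes
identically as soon as its derivative does. -/
theorem solvesFirstKind_iff (hr : 1 ≤ r) {g : ℝ → ℝ} (hg : DifferentiableOn ℝ g (Icc 0 T))
    (hg0 : g 0 = 0) {z : ℝ → ℝ} (hz : ContinuousOn z (Icc 0 T))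
    (hj : ∀ t ∈ Icc 0 T, jumpTerm T n α K z t = 0) :
    SolvesFirstKind T n α K g z ↔
      SolvesSecondKind T (resKernel T n α K) (resRhs T n K g) z := by
  have hd := fun t (ht : t ∈ Icc 0 T) => hasDerivWithinAt_firstKind hT hn hα hK hr hz ht
  have hd' := fun t (ht : t ∈ Icc 0 T) => (hd t ht).derivWithin (uniqueDiffOn_Icc hT t ht)
  have key : SolvesSecondKind T (resKernel T n α K) (resRhs T n K g) z ↔
      ∀ t ∈ Icc 0 T, K n t t * z t + jumpTerm T n α K z t +
        ∫ s in (0 : ℝ)..t, jumpKernel n α (fun i => partialFst T (K i)) t s * z s =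
        derivWithin g (Icc 0 T) t := by
    refine forall₂_congr fun t ht => ?_
    rw [integral_resKernel_mul, resRhs, hj t ht, eq_div_iff (hdiag t ht)]
    have := hdiag t ht
    refine Eq.congr_left ?_
    field_simp
    ring
  rw [key]
  refine ⟨fun h t ht => ?_, fun h t ht => ?_⟩
  · rw [← hd' t ht]
    exact derivWithin_congr h (h t ht)
  · refine eq_of_derivWithin_eq (a := 0) (b := T) (fun t ht => (hd t ht).differentiableWithinAt) hg
      (fun t ht => ?_) ?_ t ht
    · rw [hd' t (Ico_subset_Icc_self ht), h t (Ico_subset_Icc_self ht)]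
    · simp [hg0]

end ResKernel

/-! ### Volterra equations of the second kind -/

namespace IsVolterraKernel

variable {T M : ℝ} {h : ℝ → ℝ → ℝ}

lemma intervalIntegrable (hh : IsVolterraKernel T M h) {t : ℝ} (ht : t ∈ Icc 0 T) {u : ℝ → ℝ}
    {a b : ℝ} (hu : ContinuousOn u (uIcc a b)) (ha : a ∈ Icc 0 T) (hb : b ∈ Icc 0 T) :
    IntervalIntegrable (fun s => h t s * u s) volume a b := by
  have hsub := uIcc_subset_of_mem ha hb
  obtain ⟨B, hB⟩ := isCompact_uIcc.exists_bound_of_continuousOn hu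
  rw [intervalIntegrable_iff']
  refine Integrable.mono' (g := fun _ => M * B) 
    (integrableOn_const isCompact_uIcc.measure_lt_top.ne) ?_ ?_
  · exact ((hh.meas t ht).mono_measure (Measure.restrict_mono hsub le_rfl)).mul
      (hu.aestronglyMeasurable measurableSet_uIcc)
  · filter_upwards [ae_restrict_mem measurableSet_uIcc] with s hs
    rw [norm_mul]
    exact mul_le_mul (hh.bound t ht s (hsub hs)) (hB s hs) (norm_nonneg _) hh.nonneg

/-- The Volterra operator is small in the norms with exponential weight. -/
lemma abs_integral_le_exp (hh : IsVolterraKernel T M h) {lam W t : ℝ} (hl : 0 < lam) (hW : 0 ≤ W)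
    (ht : t ∈ Icc 0 T) {u : ℝ → ℝ} (hu : ∀ s ∈ Icc 0 t, |u s| ≤ W * Real.exp (lam * s)) :
    |∫ s in (0 : ℝ)..t, h t s * u s| ≤ M * W / lam * Real.exp (lam * t) := by
  have hc : Continuous fun s : ℝ => M * W * Real.exp (lam * s) := by fun_prop
  have h1 : ‖∫ s in (0 : ℝ)..t, h t s * u s‖ ≤
      ∫ s in (0 : ℝ)..t, M * W * Real.exp (lam * s) := by
    refine norm_integral_le_of_norm_le ht.1 (Eventually.of_forall fun s hs => ?_)
      (hc.intervalIntegrable _ _)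
    have hs' : s ∈ Icc 0 t := ⟨hs.1.le, hs.2⟩
    rw [norm_mul, mul_assoc]
    exact mul_le_mul (hh.bound t ht s (Icc_subset_Icc_right ht.2 hs')) (hu s hs') (norm_nonneg _)
      hh.nonneg
  rw [← Real.norm_eq_abs]
  refine h1.trans ?_
  have h2 : ∫ s in (0 : ℝ)..t, Real.exp (lam * s) = lam⁻¹ * (Real.exp (lam * t) - 1) := by
    rw [intervalIntegral.integral_comp_mul_left (fun s => Real.exp s) hl.ne', integral_exp]
    simp
  rw [intervalIntegral.integral_const_mul, h2, div_eq_mul_inv, mul_assoc (M * W)]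
  exact mul_le_mul_of_nonneg_left (mul_le_mul_of_nonneg_left (by linarith) (by positivity))
    (mul_nonneg hh.nonneg hW)

lemma integral_sub (hh : IsVolterraKernel T M h) {t : ℝ} (ht : t ∈ Icc 0 T) {u v : ℝ → ℝ}
    {a b : ℝ} (hu : ContinuousOn u (uIcc a b)) (hv : ContinuousOn v (uIcc a b))
    (ha : a ∈ Icc 0 T) (hb : b ∈ Icc 0 T) :
    (∫ s in a..b, h t s * u s) - ∫ s in a..b, h t s * v s =
      ∫ s in a..b, h t s * (u s - v s) := by
  rw [← intervalIntegral.integral_sub (hh.intervalIntegrable ht hu ha hb)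
    (hh.intervalIntegrable ht hv ha hb)]
  simp_rw [mul_sub]

/-- Unique solvability of Volterra equations of the second kind in `C[0,T]`. -/
theorem exists_solution (hT : 0 ≤ T) (hh : IsVolterraKernel T M h) {f : ℝ → ℝ}
    (hf : ContinuousOn f (Icc 0 T)) :
    ∃ x : ℝ → ℝ, ContinuousOn x (Icc 0 T) ∧ SolvesSecondKind T h f x ∧
      ∀ z : ℝ → ℝ, ContinuousOn z (Icc 0 T) → SolvesSecondKind T h f z → EqOn z x (Icc 0 T) := by
  -- In the norm with weight `e^{-λt}` the operator has norm at most `M/λ`, here at most `1/2`; the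
  -- summand `1` keeps `λ` positive when `M = 0`.
  set lam : ℝ := 2 * M + 1 with hlam
  have hl : 0 < lam := by have := hh.nonneg; positivity
  have hMl : M / lam ≤ 1 / 2 := by
    rw [div_le_div_iff₀ hl two_pos]
    linarith
  -- The unknown is rescaled to `v(t) = e^{-λt} x(t)`, so that the usual metric of `C([0,T])` is the
  -- weighted one and Banach's theorem applies directly.
  let w : C(Icc (0 : ℝ) T, ℝ) → ℝ → ℝ := fun v s => Real.exp (lam * s) * IccExtend hT v s
  have hw : ∀ v, ContinuousOn (w v) (Icc 0 T) := fun v =>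
    ((by fun_prop : Continuous fun s : ℝ => Real.exp (lam * s)).mul
      v.continuous.Icc_extend').continuousOn
  have hwe : ∀ v (s : Icc (0 : ℝ) T), w v s = Real.exp (lam * s) * v s := fun v s => by
    simp only [w, IccExtend_val]
  let Φ : C(Icc (0 : ℝ) T, ℝ) → C(Icc (0 : ℝ) T, ℝ) := fun v =>
    ⟨fun t => Real.exp (-(lam * t)) * (f t + ∫ s in (0 : ℝ)..t, h t s * w v s), by
      refine Continuous.mul (by fun_prop) ?_
      exact continuousOn_iff_continuous_domRestrict.mp (hf.add (hh.continuousOn _ (hw v)))⟩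
  have hΦ : ContractingWith (1 / 2 : NNReal) Φ := by
    refine ⟨by norm_num, LipschitzWith.of_dist_le_mul fun u v => ?_⟩
    rw [ContinuousMap.dist_le (by positivity)]
    intro t
    have ht := t.2
    simp only [Φ, ContinuousMap.coe_mk, Real.dist_eq]
    rw [← mul_sub, add_sub_add_left_eq_sub, hh.integral_sub ht
      ((hw u).mono (uIcc_zero_subset ht)) ((hw v).mono (uIcc_zero_subset ht)) ⟨le_rfl, hT⟩ ht,
      abs_mul, abs_of_pos (Real.exp_pos _)]
    have h1 := hh.abs_integral_le_exp (lam := lam) (W := dist u v) hl dist_nonneg ht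
      (u := fun s => w u s - w v s) (fun s hs => by
        have hs' : s ∈ Icc 0 T := Icc_subset_Icc_right ht.2 hs
        rw [hwe u ⟨s, hs'⟩, hwe v ⟨s, hs'⟩, ← mul_sub, abs_mul, abs_of_pos (Real.exp_pos _),
          mul_comm]
        exact mul_le_mul_of_nonneg_right
          (ContinuousMap.dist_apply_le_dist (f := u) (g := v) (⟨s, hs'⟩ : Icc (0 : ℝ) T))
          (Real.exp_pos _).le)
    refine (mul_le_mul_of_nonneg_left h1 (Real.exp_pos _).le).trans ?_
    have h2 : Real.exp (-(lam * t)) * (M * dist u v / lam * Real.exp (lam * t)) =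
        M / lam * dist u v := by
      rw [Real.exp_neg]
      field_simp
    rw [h2]
    push_cast
    exact mul_le_mul_of_nonneg_right hMl dist_nonneg
  have hsol : ∀ v, Φ v = v → SolvesSecondKind T h f (w v) := by
    intro v hv t ht
    have h1 : Φ v ⟨t, ht⟩ = v ⟨t, ht⟩ := by rw [hv]
    simp only [Φ, ContinuousMap.coe_mk] at h1
    rw [hwe v ⟨t, ht⟩, ← h1, ← mul_assoc, ← Real.exp_add]
    simp
  refine ⟨w (ContractingWith.fixedPoint Φ hΦ), hw _, hsol _ hΦ.fixedPoint_isFixedPt, ?_⟩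
  intro z hz hsz
  let v : C(Icc (0 : ℝ) T, ℝ) := ⟨fun t => Real.exp (-(lam * t)) * z t,
    Continuous.mul (by fun_prop) (continuousOn_iff_continuous_domRestrict.mp hz)⟩
  have hv : EqOn (w v) z (Icc 0 T) := by
    intro t ht
    rw [hwe v ⟨t, ht⟩]
    simp only [v, ContinuousMap.coe_mk]
    rw [← mul_assoc, ← Real.exp_add]
    simp
  have hfix : Φ v = v := by
    ext t
    simp only [Φ, v, ContinuousMap.coe_mk]
    rw [← hsz t t.2]
    have : ∫ s in (0 : ℝ)..t, h t s * w v s = ∫ s in (0 : ℝ)..t, h t s * z s :=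
      integral_congr fun s hs => by simp only [hv (uIcc_zero_subset t.2 hs)]
    rw [this]
    ring
  rw [← hΦ.fixedPoint_unique hfix]
  exact hv.symm

end IsVolterraKernel

/-- Bootstrapping in `x = f + ∫₀ᵗ h x`: if `x` is `C^k` with `k < r`, the integral is `C^{k+1}`,
hence so is `x`. -/
lemma SolvesSecondKind.contDiffOn {T : ℝ} (hT : 0 < T) {r n : ℕ} (hn : 1 ≤ n)
    {α : ℕ → ℝ → ℝ} {K : ℕ → ℝ → ℝ → ℝ} (hα : CurveSystem T r n α)
    (hK : ∀ i, 1 ≤ i → i ≤ n → MixedC T (r + 1) r (K i)) (hdiag : ∀ t ∈ Icc 0 T, K n t t ≠ 0)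
    {f x : ℝ → ℝ} (hf : ContDiffOn ℝ r f (Icc 0 T)) (hx : ContinuousOn x (Icc 0 T))
    (hs : SolvesSecondKind T (resKernel T n α K) f x) : ContDiffOn ℝ r x (Icc 0 T) := by
  suffices ∀ k ≤ r, ContDiffOn ℝ k x (Icc 0 T) from this r le_rfl
  intro k
  induction k with
  | zero => exact fun _ => by simpa using hx
  | succ k ih =>
    intro hk
    have h1 := contDiffOn_integral_resKernel hT hn hα hK hdiag hk (u := x) (ih (by omega))
    refine ((hf.of_le (by exact_mod_cast hk)).add h1).congr fun t ht => ?_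
    rw [← hs t ht]
    ring

lemma contDiffOn_resRhs {T : ℝ} (hT : 0 < T) {r n : ℕ} (hn : 1 ≤ n) {K : ℕ → ℝ → ℝ → ℝ}
    (hK : ∀ i, 1 ≤ i → i ≤ n → MixedC T (r + 1) r (K i)) (hdiag : ∀ t ∈ Icc 0 T, K n t t ≠ 0)
    {g : ℝ → ℝ} (hg : ContDiffOn ℝ (r + 1 : ℕ) g (Icc 0 T)) :
    ContDiffOn ℝ r (resRhs T n K g) (Icc 0 T) :=
  (contDiffOn_derivWithin_Icc hT hg).2.div (contDiffOn_diag hT hK hn) hdiag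

/-! ### Roots of the Legendre polynomials -/

section Legendre

/-- Rolle's theorem for finite sets of roots. -/
lemma exists_finset_roots_derivative (p : ℝ[X]) (S : Finset ℝ) (hS : ∀ x ∈ S, p.eval x = 0) :
    ∃ S' : Finset ℝ, S.card ≤ S'.card + 1 ∧
      ∀ y ∈ S', (derivative p).eval y = 0 ∧ (∃ a ∈ S, a < y) ∧ ∃ b ∈ S, y < b := by
  induction S using Finset.induction_on_max with
  | empty => exact ⟨∅, by simp, by simp⟩
  | insert m S hm ih =>
    obtain ⟨S', hc, hS'⟩ := ih fun x hx => hS x (Finset.mem_insert_of_mem hx)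
    rcases S.eq_empty_or_nonempty with rfl | hne
    · exact ⟨∅, by simp, by simp⟩
    have hM := S.max'_mem hne
    obtain ⟨c, hc1, hc2⟩ := exists_hasDerivAt_eq_zero (f := fun x => p.eval x)
      (f' := fun x => (derivative p).eval x) (hm _ hM) p.continuous.continuousOn
      (by rw [hS _ (Finset.mem_insert_of_mem hM), hS _ (Finset.mem_insert_self _ _)])
      fun x _ => p.hasDerivAt x
    -- Each earlier critical point lies below some element of `S`, whereas `c` lies above the
    -- maximum of `S`.
    have hcS : c ∉ S' := fun h => by
      obtain ⟨-, -, b, hb, hcb⟩ := hS' c h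
      exact absurd (hc1.1.trans hcb) (not_lt.mpr (S.le_max' b hb))
    refine ⟨insert c S', ?_, fun y hy => ?_⟩
    · rw [Finset.card_insert_of_notMem hcS,
        Finset.card_insert_of_notMem fun h => (hm m h).false]
      omega
    · rcases Finset.mem_insert.mp hy with rfl | hy
      · exact ⟨hc2, ⟨_, Finset.mem_insert_of_mem hM, hc1.1⟩, m, Finset.mem_insert_self _ _, hc1.2⟩
      · obtain ⟨h0, ⟨a, ha, hay⟩, b, hb, hyb⟩ := hS' y hy
        exact ⟨h0, ⟨a, Finset.mem_insert_of_mem ha, hay⟩, b, Finset.mem_insert_of_mem hb, hyb⟩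

/-- For `k < m` the `k`-th derivative of `(X² - 1)^m` still vanishes at `±1`. Together with `k`
interior roots this makes `k + 2` roots, and Rolle's theorem gives `k + 1` interior roots of the
next derivative. -/
lemma exists_roots_iterate_derivative (m k : ℕ) (hk : k ≤ m) :
    ∃ S : Finset ℝ, k ≤ S.card ∧ ∀ y ∈ S, y ∈ Ioo (-1 : ℝ) 1 ∧
      (derivative^[k] ((X ^ 2 - 1 : ℝ[X]) ^ m)).eval y = 0 := by
  induction k with
  | zero => exact ⟨∅, by simp, by simp⟩
  | succ k ih =>
    obtain ⟨S, hc, hS⟩ := ih (by omega)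
    have hend : ∀ c : ℝ, c ^ 2 = 1 → (derivative^[k] ((X ^ 2 - 1 : ℝ[X]) ^ m)).eval c = 0 := by
      intro c hc
      obtain ⟨q, hq⟩ := pow_sub_dvd_iterate_derivative_pow (X ^ 2 - 1 : ℝ[X]) m k
      rw [hq, eval_mul, eval_pow]
      simp [hc, zero_pow (by omega : m - k ≠ 0)]
    have h1 : (1 : ℝ) ∉ S := fun h => (hS 1 h).1.2.false
    have h2 : (-1 : ℝ) ∉ insert 1 S := fun h => by
      rcases Finset.mem_insert.mp h with h | h
      · norm_num at h
      · exact (hS _ h).1.1.false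
    obtain ⟨S', hc', hS'⟩ := exists_finset_roots_derivative
      (derivative^[k] ((X ^ 2 - 1 : ℝ[X]) ^ m)) (insert (-1) (insert 1 S)) (by
        intro x hx
        rcases Finset.mem_insert.mp hx with rfl | hx
        · exact hend _ (by norm_num)
        rcases Finset.mem_insert.mp hx with rfl | hx
        · exact hend _ (by norm_num)
        exact (hS x hx).2)
    rw [Finset.card_insert_of_notMem h2, Finset.card_insert_of_notMem h1] at hc'
    have hmem : ∀ x ∈ insert (-1) (insert 1 S), x ∈ Icc (-1 : ℝ) 1 := by
      intro x hx
      rcases Finset.mem_insert.mp hx with rfl | hx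
      · norm_num
      rcases Finset.mem_insert.mp hx with rfl | hx
      · norm_num
      exact Ioo_subset_Icc_self (hS x hx).1
    refine ⟨S', by omega, fun y hy => ?_⟩
    obtain ⟨h0, ⟨a, ha, hay⟩, b, hb, hyb⟩ := hS' y hy
    rw [Function.iterate_succ_apply']
    exact ⟨⟨(hmem a ha).1.trans_lt hay, hyb.trans_le (hmem b hb).2⟩, h0⟩

lemma natDegree_sq_sub_one_pow (m : ℕ) : ((X ^ 2 - 1 : ℝ[X]) ^ m).natDegree = 2 * m := by
  rw [natDegree_pow, (by simp : (1 : ℝ[X]) = C 1), natDegree_X_pow_sub_C, mul_comm]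

lemma natDegree_legendre_le (m : ℕ) : (legendre m).natDegree ≤ m := by
  refine (natDegree_C_mul_le _ _).trans ((natDegree_iterate_derivative _ _).trans ?_)
  rw [natDegree_sq_sub_one_pow]
  omega

/-- The coefficient of `X^m` is a nonzero multiple of the leading coefficient of the monic
polynomial `(X² - 1)^m`. -/
lemma legendre_ne_zero (m : ℕ) : legendre m ≠ 0 := by
  have h1 : (C ((2 ^ m * (m.factorial : ℝ))⁻¹) : ℝ[X]) ≠ 0 := by
    rw [Ne, C_eq_zero]
    positivity
  refine mul_ne_zero h1 fun h => ?_
  have h2 := congrArg (fun p => p.coeff m) h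
  simp only [coeff_iterate_derivative, coeff_zero, nsmul_eq_mul] at h2
  have h3 : ((X ^ 2 - 1 : ℝ[X]) ^ m).Monic := by
    have := monic_X_pow_sub_C (1 : ℝ) two_ne_zero
    rw [C_1] at this
    exact this.pow m
  have h4 : ((X ^ 2 - 1 : ℝ[X]) ^ m).coeff (m + m) = 1 := by
    rw [← two_mul, ← natDegree_sq_sub_one_pow m]
    exact h3
  rw [h4, mul_one, Nat.cast_eq_zero, Nat.descFactorial_eq_zero_iff_lt] at h2
  omega

/-- The Legendre polynomial of degree `m` has `m` distinct roots, all in `(-1,1)`. -/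
theorem legendre_roots (m : ℕ) :
    (legendre m).roots.toFinset.card = m ∧ ∀ y ∈ (legendre m).roots.toFinset, y ∈ Ioo (-1 : ℝ) 1 := by
  obtain ⟨S, hc, hS⟩ := exists_roots_iterate_derivative m m le_rfl
  have hsub : S ⊆ (legendre m).roots.toFinset := fun y hy => by
    rw [Multiset.mem_toFinset, mem_roots (legendre_ne_zero m), IsRoot, legendre, eval_mul,
      (hS y hy).2, mul_zero]
  have hle : (legendre m).roots.toFinset.card ≤ m :=
    (Multiset.toFinset_card_le _).trans ((card_roots' _).trans (natDegree_legendre_le m))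
  -- Rolle gives at least `m` roots and the degree allows at most `m`, so `S` is the whole root set
  -- and its location in `(-1,1)` carries over.
  have heq := Finset.eq_of_subset_of_card_le hsub (hle.trans hc)
  refine ⟨le_antisymm hle (hc.trans (Finset.card_le_card hsub)), fun y hy => ?_⟩
  rw [← heq] at hy
  exact (hS y hy).1

end Legendre

/-! ### Interpolation on a cell and its Lebesgue constant -/

section Interpolation

/-- The interpolation nodes in the reference cell `[-1,1]`. -/
def refNodes (r : ℕ) : Finset ℝ := {-1, 1} ∪ (legendre (r - 2)).roots.toFinset

lemma card_refNodes {r : ℕ} (hr : 2 ≤ r) : (refNodes r).card = r := by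
  obtain ⟨hc, hI⟩ := legendre_roots (r - 2)
  rw [refNodes, Finset.card_union_of_disjoint, hc, Finset.card_pair (by norm_num)]
  · omega
  · rw [Finset.disjoint_left]
    intro y hy hy'
    have := hI y hy'
    rcases Finset.mem_insert.mp hy with rfl | hy
    · exact this.1.false
    · rw [Finset.mem_singleton] at hy
      subst hy
      exact this.2.false

lemma refNodes_subset {r : ℕ} {y : ℝ} (hy : y ∈ refNodes r) : y ∈ Icc (-1 : ℝ) 1 := by
  rcases Finset.mem_union.mp hy with hy | hy
  · rcases Finset.mem_insert.mp hy with rfl | hy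
    · norm_num
    · rw [Finset.mem_singleton] at hy
      subst hy
      norm_num
  · exact Ioo_subset_Icc_self ((legendre_roots _).2 y hy)

lemma cellNodes_eq_image (r : ℕ) (a b : ℝ) :
    cellNodes r a b = (refNodes r).image fun y => (a + b) / 2 + (b - a) / 2 * y := by
  rw [cellNodes, refNodes, Finset.image_union, Finset.image_insert, Finset.image_singleton]
  congr 2
  · ring
  · congr 1
    ring

lemma affine_mem_Icc {a b y : ℝ} (hab : a ≤ b) (hy : y ∈ Icc (-1 : ℝ) 1) :
    (a + b) / 2 + (b - a) / 2 * y ∈ Icc a b := by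
  constructor <;> nlinarith [hy.1, hy.2]

lemma cellNodes_subset {r : ℕ} {a b t : ℝ} (hab : a ≤ b) (ht : t ∈ cellNodes r a b) :
    t ∈ Icc a b := by
  rw [cellNodes_eq_image] at ht
  obtain ⟨y, hy, rfl⟩ := Finset.mem_image.mp ht
  exact affine_mem_Icc hab (refNodes_subset hy)

lemma card_cellNodes {r : ℕ} (hr : 2 ≤ r) {a b : ℝ} (hab : a < b) :
    (cellNodes r a b).card = r := by
  rw [cellNodes_eq_image, Finset.card_image_of_injective, card_refNodes hr]
  intro x y hxy
  have : (b - a) / 2 ≠ 0 := by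
    have := sub_pos.mpr hab
    positivity
  exact mul_left_cancel₀ this (add_left_cancel hxy)

lemma left_mem_cellNodes (r : ℕ) (a b : ℝ) : a ∈ cellNodes r a b := by simp [cellNodes]

lemma right_mem_cellNodes (r : ℕ) (a b : ℝ) : b ∈ cellNodes r a b := by simp [cellNodes]

/-- Interpolation at the nodes of the cell `[a,b]`. -/
abbrev nodeInterp (r : ℕ) (a b : ℝ) (u : ℝ → ℝ) : ℝ[X] :=
  Lagrange.interpolate (cellNodes r a b) id u

variable {r : ℕ} {a b : ℝ}

lemma degree_nodeInterp (hr : 2 ≤ r) (hab : a < b) (u : ℝ → ℝ) :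
    (nodeInterp r a b u).degree < (r : WithBot ℕ) := by
  have := Lagrange.degree_interpolate_lt (s := cellNodes r a b) (v := id) u (injOn_id _)
  rwa [card_cellNodes hr hab] at this

lemma eval_nodeInterp (u : ℝ → ℝ) {t : ℝ} (ht : t ∈ cellNodes r a b) :
    (nodeInterp r a b u).eval t = u t :=
  Lagrange.eval_interpolate_at_node u (injOn_id _) ht

lemma nodeInterp_congr {u v : ℝ → ℝ} (h : ∀ t ∈ cellNodes r a b, u t = v t) :
    nodeInterp r a b u = nodeInterp r a b v :=
  Lagrange.interpolate_eq_of_values_eq_on _ _ h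

lemma nodeInterp_poly (hr : 2 ≤ r) (hab : a < b) {p : ℝ[X]} (hp : p.degree < (r : WithBot ℕ)) :
    nodeInterp r a b (fun t => p.eval t) = p := by
  refine (Lagrange.eq_interpolate_of_eval_eq _ (injOn_id _) ?_ fun i _ => rfl).symm
  rwa [card_cellNodes hr hab]

lemma degree_comp_affine (hr : 0 < r) {p : ℝ[X]} (hp : p.degree < (r : WithBot ℕ)) (c d : ℝ) :
    (p.comp (C c + C d * X)).degree < (r : WithBot ℕ) := by
  have h1 : p.natDegree < r := by
    rcases eq_or_ne p 0 with rfl | h0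
    · simpa
    · exact (natDegree_lt_iff_degree_lt h0).mpr hp
  have h2 : (C c + C d * X : ℝ[X]).natDegree ≤ 1 := by
    rw [add_comm]
    exact natDegree_linear_le
  have h3 : (p.comp (C c + C d * X)).natDegree < r := by
    refine lt_of_le_of_lt (natDegree_comp_le.trans ?_) h1
    exact (Nat.mul_le_mul_left _ h2).trans (by simp)
  exact degree_le_natDegree.trans_lt (by exact_mod_cast h3)

/-- The interpolation operators of all cells have a common bound. -/
theorem exists_lebesgue_constant (hr : 2 ≤ r) : ∃ Λ : ℝ, 0 < Λ ∧ ∀ a b : ℝ, a < b →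
    ∀ (u : ℝ → ℝ) (B : ℝ), (∀ t ∈ cellNodes r a b, |u t| ≤ B) →
      ∀ t ∈ Icc a b, |(nodeInterp r a b u).eval t| ≤ Λ * B := by
  have hcont : Continuous fun y : ℝ =>
      ∑ i ∈ refNodes r, |(Lagrange.basis (refNodes r) id i).eval y| :=
    continuous_finsetSum _ fun i _ => (Polynomial.continuous _).abs
  obtain ⟨L, hL⟩ := (isCompact_Icc (a := (-1 : ℝ)) (b := 1)).exists_bound_of_continuousOn
    hcont.continuousOn
  -- `L` bounds the Lebesgue function of the reference nodes on `[-1,1]`; the maximum with `1` makes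
  -- positivity immediate.
  refine ⟨max L 1, lt_max_of_lt_right one_pos, fun a b hab u B hB t ht => ?_⟩
  have hB0 : 0 ≤ B := (abs_nonneg _).trans (hB a (left_mem_cellNodes r a b))
  set φ : ℝ → ℝ := fun y => (a + b) / 2 + (b - a) / 2 * y with hφ
  have hmem : ∀ y ∈ refNodes r, φ y ∈ cellNodes r a b := fun y hy => by
    rw [cellNodes_eq_image]
    exact Finset.mem_image_of_mem _ hy
  -- Pulled back to `[-1,1]`, the interpolant of any cell is an interpolant at the reference nodes,
  -- so the bound is independent of the cell.
  set q : ℝ[X] := (nodeInterp r a b u).comp (C ((a + b) / 2) + C ((b - a) / 2) * X) with hq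
  have hqe : ∀ y, q.eval y = (nodeInterp r a b u).eval (φ y) := fun y => by
    simp only [hq, hφ, eval_comp, eval_add, eval_mul, eval_C, eval_X]
  have hqi : q = Lagrange.interpolate (refNodes r) id (fun y => u (φ y)) := by
    refine Lagrange.eq_interpolate_of_eval_eq _ (injOn_id _) ?_ fun y hy => ?_
    · rw [card_refNodes hr]
      exact degree_comp_affine (by omega) (degree_nodeInterp hr hab u) _ _
    · rw [id, hqe, eval_nodeInterp u (hmem y hy)]
  set y : ℝ := (t - (a + b) / 2) / ((b - a) / 2) with hy
  have hd : 0 < (b - a) / 2 := by linarith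
  have hφy : φ y = t := by
    simp only [hφ, hy]
    rw [mul_div_cancel₀ _ hd.ne']
    ring
  have hyI : y ∈ Icc (-1 : ℝ) 1 := by
    rw [hy, mem_Icc, le_div_iff₀ hd, div_le_iff₀ hd]
    constructor <;> linarith [ht.1, ht.2]
  rw [← hφy, ← hqe, hqi, Lagrange.interpolate_apply, eval_finsetSum]
  refine (Finset.abs_sum_le_sum_abs _ _).trans ?_
  calc ∑ i ∈ refNodes r, |(C (u (φ i)) * Lagrange.basis (refNodes r) id i).eval y|
      ≤ ∑ i ∈ refNodes r, B * |(Lagrange.basis (refNodes r) id i).eval y| := by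
        refine Finset.sum_le_sum fun i hi => ?_
        rw [eval_mul, eval_C, abs_mul]
        exact mul_le_mul_of_nonneg_right (hB _ (hmem i hi)) (abs_nonneg _)
    _ = (∑ i ∈ refNodes r, |(Lagrange.basis (refNodes r) id i).eval y|) * B := by
        rw [← Finset.mul_sum, mul_comm]
    _ ≤ max L 1 * B := mul_le_mul_of_nonneg_right
        (((le_abs_self _).trans (hL y hyI)).trans (le_max_left _ _)) hB0

end Interpolation

/-! ### The uniform grid -/

section Grid

variable {T : ℝ} {N : ℕ}

lemma gridPt_zero : gridPt T N 0 = 0 := by simp [gridPt]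

lemma gridPt_last (hN : 1 ≤ N) : gridPt T N N = T := by
  have : (N : ℝ) ≠ 0 := by exact_mod_cast (by omega : N ≠ 0)
  rw [gridPt, mul_div_cancel_left₀ _ this]

lemma gridPt_succ_sub (k : ℕ) : gridPt T N (k + 1) - gridPt T N k = T / N := by
  simp only [gridPt]
  push_cast
  ring

lemma gridPt_lt_succ (hT : 0 < T) (hN : 1 ≤ N) (k : ℕ) : gridPt T N k < gridPt T N (k + 1) := by
  have h1 : 0 < T / N := div_pos hT (by exact_mod_cast hN)
  linarith [gridPt_succ_sub (T := T) (N := N) k]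

lemma gridPt_mono (hT : 0 < T) : Monotone (gridPt T N) := fun i j hij => by
  have : (i : ℝ) ≤ j := by exact_mod_cast hij
  simp only [gridPt]
  gcongr

lemma gridPt_mem (hT : 0 < T) (hN : 1 ≤ N) {k : ℕ} (hk : k ≤ N) : gridPt T N k ∈ Icc 0 T := by
  constructor
  · rw [← gridPt_zero (T := T) (N := N)]
    exact gridPt_mono hT (Nat.zero_le k)
  · exact (gridPt_mono hT hk).trans_eq (gridPt_last hN)

lemma cell_subset (hT : 0 < T) (hN : 1 ≤ N) {k : ℕ} (hk : k < N) :
    Icc (gridPt T N k) (gridPt T N (k + 1)) ⊆ Icc 0 T :=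
  Icc_subset_Icc (gridPt_mem hT hN hk.le).1 (gridPt_mem hT hN hk).2

lemma exists_mem_cell {t : ℝ} {m : ℕ} (hm : 1 ≤ m) (ht : t ∈ Icc 0 (gridPt T N m)) :
    ∃ k < m, t ∈ Icc (gridPt T N k) (gridPt T N (k + 1)) := by
  induction m, hm using Nat.le_induction with
  | base => exact ⟨0, one_pos, by rwa [gridPt_zero]⟩
  | succ m hm ih =>
    rcases le_total t (gridPt T N m) with h | h
    · obtain ⟨k, hk, hkt⟩ := ih ⟨ht.1, h⟩
      exact ⟨k, by omega, hkt⟩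
    · exact ⟨m, by omega, h, ht.2⟩

lemma exists_mem_cell_of_mem (hN : 1 ≤ N) {t : ℝ} (ht : t ∈ Icc 0 T) :
    ∃ k < N, t ∈ Icc (gridPt T N k) (gridPt T N (k + 1)) :=
  exists_mem_cell hN (by rwa [gridPt_last hN])

end Grid

lemma eq_zero_of_eval_eq_zero_Icc {a b : ℝ} (hab : a < b) {p : ℝ[X]}
    (h : ∀ t ∈ Icc a b, p.eval t = 0) : p = 0 :=
  eq_zero_of_infinite_isRoot p ((Icc_infinite hab).mono h)

/-! ### The collocation equation in one cell -/

section Cell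

variable {T M Λ a b : ℝ} {h : ℝ → ℝ → ℝ} {r : ℕ}

lemma IsVolterraKernel.abs_integral_le (hh : IsVolterraKernel T M h) (ha : 0 ≤ a) (hb : b ≤ T)
    {t : ℝ} (ht : t ∈ Icc a b) {u : ℝ → ℝ} {E : ℝ} (hE : ∀ s ∈ Icc a b, |u s| ≤ E) :
    |∫ s in a..t, h t s * u s| ≤ M * E * (b - a) := by
  have h1 : ‖∫ s in a..t, h t s * u s‖ ≤ M * E * |t - a| := by
    refine norm_integral_le_of_norm_le_const fun s hs => ?_
    rw [uIoc_of_le ht.1] at hs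
    have hs' : s ∈ Icc a b := ⟨hs.1.le, hs.2.trans ht.2⟩
    rw [norm_mul]
    exact mul_le_mul (hh.bound t ⟨ha.trans ht.1, ht.2.trans hb⟩ s
      ⟨ha.trans hs'.1, hs'.2.trans hb⟩) (hE s hs') (norm_nonneg _) hh.nonneg
  refine h1.trans (mul_le_mul_of_nonneg_left ?_ (mul_nonneg hh.nonneg ?_))
  · rw [abs_of_nonneg (by linarith [ht.1])]
    linarith [ht.2]
  · exact (abs_nonneg _).trans (hE t ht)

/-- The collocation operator of a cell. -/
abbrev cellOp (h : ℝ → ℝ → ℝ) (r : ℕ) (a b : ℝ) (p : ℝ[X]) : ℝ[X] :=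
  p - nodeInterp r a b (fun t => ∫ s in a..t, h t s * p.eval s)

/-- Here `p` is the interpolant of its own Volterra integral. At a maximum point of `|p|` this gives
`|p| ≤ ΛM(b - a)|p|` with a factor below `1`, so `p` vanishes on the cell. -/
lemma cellOp_eq_zero (hh : IsVolterraKernel T M h)
    (hΛb : ∀ (u : ℝ → ℝ) (B : ℝ), (∀ t ∈ cellNodes r a b, |u t| ≤ B) →
      ∀ t ∈ Icc a b, |(nodeInterp r a b u).eval t| ≤ Λ * B)
    (ha : 0 ≤ a) (hab : a < b) (hb : b ≤ T) (hsmall : Λ * M * (b - a) < 1) {p : ℝ[X]}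
    (hp : cellOp h r a b p = 0) : p = 0 := by
  obtain ⟨t₀, ht₀, hmax⟩ := isCompact_Icc.exists_isMaxOn (nonempty_Icc.mpr hab.le)
    (p.continuous.abs.continuousOn (s := Icc a b))
  have hE : ∀ s ∈ Icc a b, |p.eval s| ≤ |p.eval t₀| := fun s hs => hmax hs
  have h1 := hΛb (fun t => ∫ s in a..t, h t s * p.eval s) (M * |p.eval t₀| * (b - a))
    (fun t ht => hh.abs_integral_le ha hb (cellNodes_subset hab.le ht) hE) t₀ ht₀
  rw [← sub_eq_zero.mp hp] at h1
  have h2 : |p.eval t₀| ≤ 0 := by nlinarith [abs_nonneg (p.eval t₀)]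
  exact eq_zero_of_eval_eq_zero_Icc hab fun s hs => abs_eq_zero.mp
    (le_antisymm ((hE s hs).trans h2) (abs_nonneg _))

lemma cellOp_add_smul (hh : IsVolterraKernel T M h) (ha : 0 ≤ a) (hab : a ≤ b) (hb : b ≤ T)
    (c : ℝ) (p q : ℝ[X]) :
    cellOp h r a b (c • p + q) = c • cellOp h r a b p + cellOp h r a b q := by
  have h1 : nodeInterp r a b (fun t => ∫ s in a..t, h t s * (c • p + q).eval s) =
      nodeInterp r a b (c • (fun t => ∫ s in a..t, h t s * p.eval s) +
        fun t => ∫ s in a..t, h t s * q.eval s) := by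
    refine nodeInterp_congr fun t ht => ?_
    have ht' := cellNodes_subset hab ht
    have htT : t ∈ Icc 0 T := ⟨ha.trans ht'.1, ht'.2.trans hb⟩
    have haT : a ∈ Icc 0 T := ⟨ha, hab.trans hb⟩
    have hi : ∀ p : ℝ[X], IntervalIntegrable (fun s => h t s * p.eval s) volume a t := fun p =>
      hh.intervalIntegrable htT p.continuous.continuousOn haT htT
    rw [Pi.add_apply, Pi.smul_apply, smul_eq_mul, ← intervalIntegral.integral_const_mul,
      ← intervalIntegral.integral_add ((hi p).const_mul c) (hi q)]
    refine integral_congr fun s _ => ?_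
    simp only [eval_add, eval_smul, smul_eq_mul]
    ring
  simp only [cellOp]
  rw [h1, nodeInterp, map_add, map_smul, smul_sub]
  abel

lemma cellOp_sub (hh : IsVolterraKernel T M h) (ha : 0 ≤ a) (hab : a ≤ b) (hb : b ≤ T)
    (p q : ℝ[X]) : cellOp h r a b (p - q) = cellOp h r a b p - cellOp h r a b q := by
  have := cellOp_add_smul (r := r) hh ha hab hb (-1) q p
  rw [neg_one_smul, neg_add_eq_sub, neg_one_smul, neg_add_eq_sub] at this
  exact this

/-- Unique solvability of the collocation equation in a short cell. -/
theorem exists_cell_solution (hr : 2 ≤ r) (hh : IsVolterraKernel T M h)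
    (hΛb : ∀ (u : ℝ → ℝ) (B : ℝ), (∀ t ∈ cellNodes r a b, |u t| ≤ B) →
      ∀ t ∈ Icc a b, |(nodeInterp r a b u).eval t| ≤ Λ * B)
    (ha : 0 ≤ a) (hab : a < b) (hb : b ≤ T) (hsmall : Λ * M * (b - a) < 1) (F : ℝ → ℝ) :
    ∃ p : ℝ[X], p.degree < (r : WithBot ℕ) ∧ cellOp h r a b p = nodeInterp r a b F := by
  have hmem : ∀ p ∈ degreeLT ℝ r, cellOp h r a b p ∈ degreeLT ℝ r := fun p hp =>
    Submodule.sub_mem _ hp (mem_degreeLT.mpr (degree_nodeInterp hr hab _))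
  -- The collocation operator is an endomorphism of a finite-dimensional space, so injectivity
  -- already gives solvability.
  let L : degreeLT ℝ r →ₗ[ℝ] degreeLT ℝ r :=
    { toFun := fun p => ⟨cellOp h r a b p, hmem p p.2⟩
      map_add' := fun p q => Subtype.ext (by
        simpa using cellOp_add_smul (r := r) hh ha hab.le hb 1 (p : ℝ[X]) q)
      map_smul' := fun c p => Subtype.ext (by
        have h0 : cellOp h r a b (0 : ℝ[X]) = 0 := by
          simp
        have := cellOp_add_smul (r := r) hh ha hab.le hb c (p : ℝ[X]) 0
        rw [h0, add_zero, add_zero] at this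
        exact this) }
  have hinj : Function.Injective L := by
    rw [← LinearMap.ker_eq_bot, LinearMap.ker_eq_bot']
    intro p hp
    exact Subtype.ext (cellOp_eq_zero hh hΛb ha hab hb hsmall (congrArg Subtype.val hp))
  have : Module.Finite ℝ (degreeLT ℝ r) := Module.Finite.equiv (degreeLTEquiv ℝ r).symm
  obtain ⟨p, hp⟩ := LinearMap.injective_iff_surjective.mp hinj
    ⟨nodeInterp r a b F, mem_degreeLT.mpr (degree_nodeInterp hr hab _)⟩
  exact ⟨p, mem_degreeLT.mp p.2, congrArg Subtype.val hp⟩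

end Cell

/-- The collocation condition in the single cell `Δ_k`. -/
def SolvesCell (T : ℝ) (r N : ℕ) (h : ℝ → ℝ → ℝ) (f y : ℝ → ℝ) (k : ℕ) : Prop :=
  ∃ p : ℝ[X], p.degree < (r : WithBot ℕ) ∧
    (∀ t ∈ Icc (gridPt T N k) (gridPt T N (k + 1)), y t = p.eval t) ∧
    cellOp h r (gridPt T N k) (gridPt T N (k + 1)) p =
      nodeInterp r (gridPt T N k) (gridPt T N (k + 1)) (stepRhs T N k h f y)

lemma isCollocationSpline_iff {T : ℝ} {r N : ℕ} {h : ℝ → ℝ → ℝ} {f y : ℝ → ℝ} :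
    IsCollocationSpline T r N h f y ↔ ∀ k < N, SolvesCell T r N h f y k := Iff.rfl

/-! ### Existence, uniqueness and continuity of the spline -/

section Spline

variable {T M Λ : ℝ} {h : ℝ → ℝ → ℝ} {r N : ℕ} {f : ℝ → ℝ}

/-- Causality: `f_k` sees only the cells before `Δ_k`. This permits both the cell-by-cell
construction and the inductive uniqueness proof. -/
lemma stepRhs_congr (hT : 0 < T) {y z : ℝ → ℝ} {k : ℕ}
    (hyz : ∀ l < k, EqOn y z (Icc (gridPt T N l) (gridPt T N (l + 1)))) :
    stepRhs T N k h f y = stepRhs T N k h f z := by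
  funext t
  simp only [stepRhs]
  congr 1
  refine Finset.sum_congr rfl fun l hl => integral_congr fun s hs => ?_
  rw [uIcc_of_le (gridPt_mono hT l.le_succ)] at hs
  simp only [hyz l (Finset.mem_range.mp hl) hs]

variable (hT : 0 < T) (hr : 2 ≤ r) (hN : 1 ≤ N) (hh : IsVolterraKernel T M h)
  (hΛb : ∀ a b : ℝ, a < b → ∀ (u : ℝ → ℝ) (B : ℝ), (∀ t ∈ cellNodes r a b, |u t| ≤ B) →
      ∀ t ∈ Icc a b, |(nodeInterp r a b u).eval t| ≤ Λ * B)
  (hsmall : Λ * M * (T / N) < 1)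

include hT hr hN hh hΛb hsmall

/-- The last clause, `y(t_m) = f_m(t_m)`, is the matching condition for the next cell. Neighbouring
closed cells share a grid point, so without it the pieces would not define a function. -/
lemma exists_partial_spline (m : ℕ) (hm : m ≤ N) :
    ∃ y : ℝ → ℝ, ContinuousOn y (Icc 0 (gridPt T N m)) ∧ (∀ k < m, SolvesCell T r N h f y k) ∧
      y (gridPt T N m) = stepRhs T N m h f y (gridPt T N m) := by
  induction m with
  | zero => exact ⟨fun _ => f 0, continuousOn_const, by simp, by simp [stepRhs, gridPt_zero]⟩
  | succ m ih =>
    obtain ⟨y, hyc, hys, hye⟩ := ih (by omega)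
    set a := gridPt T N m with ha
    set b := gridPt T N (m + 1) with hb
    have hab : a < b := gridPt_lt_succ hT hN m
    have haI : a ∈ Icc 0 T := gridPt_mem hT hN (by omega)
    have hbI : b ∈ Icc 0 T := gridPt_mem hT hN hm
    obtain ⟨p, hpd, hp⟩ := exists_cell_solution hr hh (hΛb a b hab) haI.1 hab hbI.2
      (by rwa [gridPt_succ_sub]) (stepRhs T N m h f y)
    have hnode : ∀ t ∈ cellNodes r a b,
        p.eval t = stepRhs T N m h f y t + ∫ s in a..t, h t s * p.eval s := by
      intro t ht
      have := congrArg (fun q => q.eval t) hp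
      simp only [cellOp, eval_sub] at this
      rw [eval_nodeInterp _ ht, eval_nodeInterp _ ht] at this
      linarith
    let z : ℝ → ℝ := fun t => if t ≤ a then y t else p.eval t
    have hzy : EqOn z y (Icc 0 a) := fun t ht => by simp [z, ht.2]
    -- The left endpoint is a node and the local integral vanishes there, so the new piece takes the
    -- value `f_m(t_m)`.
    have hpa : p.eval a = y a := by
      rw [hnode a (left_mem_cellNodes r a b), integral_same, add_zero, hye]
    have hzp : EqOn z (fun t => p.eval t) (Icc a b) := fun t ht => by
      rcases ht.1.eq_or_lt with h | h
      · simp [z, ← h, hpa]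
      · simp [z, not_le.mpr h]
    have hcell : ∀ l < m, EqOn z y (Icc (gridPt T N l) (gridPt T N (l + 1))) := fun l hl =>
      hzy.mono (Icc_subset_Icc (gridPt_mem hT hN (by omega)).1 (gridPt_mono hT hl))
    have hstep : ∀ k ≤ m, stepRhs T N k h f z = stepRhs T N k h f y := fun k hk =>
      stepRhs_congr hT fun l hl => hcell l (by omega)
    refine ⟨z, ?_, fun k hk => ?_, ?_⟩
    · rw [← Icc_union_Icc_eq_Icc haI.1 hab.le]
      exact (hyc.congr hzy).union_of_isClosed (p.continuous.continuousOn.congr hzp)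
        isClosed_Icc isClosed_Icc
    · rcases (Nat.lt_succ_iff.mp hk).eq_or_lt with rfl | hk
      · exact ⟨p, hpd, hzp, by rw [hstep k le_rfl]; exact hp⟩
      · obtain ⟨q, hqd, hq, hqe⟩ := hys k hk
        exact ⟨q, hqd, fun t ht => (hcell k hk ht).trans (hq t ht), by rw [hstep k hk.le]; exact hqe⟩
    -- The right endpoint is a node too: collocation there reads `p(b) = f_m(b) + ∫ₐᵇ h(b,s) p(s)
    -- ds`, and the right side is `f_{m+1}(b)`. The matching condition is thereby passed on.
    · have h1 : ∫ s in a..b, h b s * z s = ∫ s in a..b, h b s * p.eval s :=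
        integral_congr fun s hs => by
          rw [uIcc_of_le hab.le] at hs
          simp only [hzp hs]
      have h2 : stepRhs T N (m + 1) h f z b =
          stepRhs T N m h f z b + ∫ s in a..b, h b s * z s := by
        simp only [stepRhs, Finset.sum_range_succ, ← ha, ← hb, add_assoc]
      rw [h2, h1, hstep m le_rfl, ← hnode b (right_mem_cellNodes r a b)]
      exact hzp (right_mem_Icc.mpr hab.le)

omit hr in
/-- Uniqueness of the collocation spline. -/
lemma IsCollocationSpline.eqOn {y z : ℝ → ℝ} (hz : IsCollocationSpline T r N h f z)
    (hy : IsCollocationSpline T r N h f y) : EqOn z y (Icc 0 T) := by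
  have key : ∀ k < N, EqOn z y (Icc (gridPt T N k) (gridPt T N (k + 1))) := by
    intro k
    induction k using Nat.strong_induction_on with
    | _ k ih =>
      intro hk t ht
      obtain ⟨p, -, hp, hpe⟩ := isCollocationSpline_iff.mp hz k hk
      obtain ⟨q, -, hq, hqe⟩ := isCollocationSpline_iff.mp hy k hk
      have h1 := stepRhs_congr (h := h) (f := f) hT fun l hl => ih l hl (hl.trans hk)
      have hab := gridPt_lt_succ hT hN k
      have ha := gridPt_mem hT hN hk.le
      have hb := gridPt_mem hT hN (k := k + 1) hk
      rw [h1, ← hqe, ← sub_eq_zero, ← cellOp_sub hh ha.1 hab.le hb.2] at hpe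
      have h2 := cellOp_eq_zero hh (hΛb _ _ hab) ha.1 hab hb.2
        (by rwa [gridPt_succ_sub]) hpe
      rw [hp t ht, hq t ht, sub_eq_zero.mp h2]
  intro t ht
  obtain ⟨k, hk, hkt⟩ := exists_mem_cell_of_mem hN ht
  exact key k hk hkt

/-- Existence and continuity of the collocation spline. -/
theorem exists_collocationSpline (f : ℝ → ℝ) :
    ∃ y : ℝ → ℝ, ContinuousOn y (Icc 0 T) ∧ IsCollocationSpline T r N h f y := by
  obtain ⟨y, hyc, hys, -⟩ :=
    exists_partial_spline (f := f) hT hr hN hh hΛb hsmall N le_rfl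
  rw [gridPt_last hN] at hyc
  exact ⟨y, hyc, hys⟩

/-- Uniqueness transfers continuity from the constructed spline to any other. -/
lemma IsCollocationSpline.continuousOn {y : ℝ → ℝ} (hy : IsCollocationSpline T r N h f y) :
    ContinuousOn y (Icc 0 T) := by
  obtain ⟨z, hzc, hz⟩ := exists_collocationSpline hT hr hN hh hΛb hsmall f
  exact hzc.congr (hy.eqOn hT hN hh hΛb hsmall hz)

end Spline

/-! ### Stability: the upper error estimate -/

section Error

variable {T M Λ lam D : ℝ} {h : ℝ → ℝ → ℝ} {r N : ℕ} {f x y : ℝ → ℝ}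

/-- The defect of the collocation spline at the nodes, in terms of the error `x - y`. -/
lemma IsCollocationSpline.exists_cell_poly (hT : 0 < T) (hN : 1 ≤ N)
    (hh : IsVolterraKernel T M h) (hx : ContinuousOn x (Icc 0 T))
    (hsx : SolvesSecondKind T h f x) (hyc : ContinuousOn y (Icc 0 T))
    (hy : IsCollocationSpline T r N h f y) {k : ℕ} (hk : k < N) :
    ∃ p : ℝ[X], p.degree < (r : WithBot ℕ) ∧
      (∀ t ∈ Icc (gridPt T N k) (gridPt T N (k + 1)), y t = p.eval t) ∧
      p = nodeInterp r (gridPt T N k) (gridPt T N (k + 1))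
        fun t => x t - ∫ s in (0 : ℝ)..t, h t s * (x s - y s) := by
  obtain ⟨p, hpd, hp, hpe⟩ := isCollocationSpline_iff.mp hy k hk
  refine ⟨p, hpd, hp, ?_⟩
  rw [cellOp, sub_eq_iff_eq_add, nodeInterp, nodeInterp, ← map_add] at hpe
  rw [hpe]
  refine nodeInterp_congr fun t ht => ?_
  have hab := (gridPt_lt_succ hT hN k).le
  have htc := cellNodes_subset hab ht
  have htI := cell_subset hT hN hk htc
  have h0 : (0 : ℝ) ∈ Icc 0 T := ⟨le_rfl, hT.le⟩
  have hint : ∀ c ∈ Icc 0 T, ∀ d ∈ Icc 0 T,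
      IntervalIntegrable (fun s => h t s * y s) volume c d := fun c hc d hd =>
    hh.intervalIntegrable htI (hyc.mono (uIcc_subset_of_mem hc hd)) hc hd
  have h1 : ∑ l ∈ Finset.range k, ∫ s in gridPt T N l..gridPt T N (l + 1), h t s * y s =
      ∫ s in (0 : ℝ)..gridPt T N k, h t s * y s := by
    rw [sum_integral_adjacent_intervals fun l hl =>
      hint _ (gridPt_mem hT hN (by omega)) _ (gridPt_mem hT hN (by omega)), gridPt_zero]
  have h2 : ∫ s in gridPt T N k..t, h t s * p.eval s = ∫ s in gridPt T N k..t, h t s * y s :=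
    integral_congr fun s hs => by
      rw [uIcc_of_le htc.1] at hs
      simp only [hp s ⟨hs.1, hs.2.trans htc.2⟩]
  have hkI := gridPt_mem hT hN hk.le
  -- The earlier cells and the current one add up to `∫₀ᵗ h y`; substituting `f = x - ∫₀ᵗ h x`
  -- leaves `x - ∫₀ᵗ h(x - y)` at each node.
  rw [Pi.add_apply, stepRhs, h1, h2, ← hsx t htI, add_assoc,
    integral_add_adjacent_intervals (hint _ h0 _ hkI) (hint _ hkI _ htI),
    ← hh.integral_sub htI (hx.mono (uIcc_zero_subset htI)) (hyc.mono (uIcc_zero_subset htI)) h0 htI]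
  ring

/-- The error of collocation is bounded by the error of piecewise polynomial approximation. -/
theorem IsCollocationSpline.abs_sub_le (hT : 0 < T) (hr : 2 ≤ r) (hN : 1 ≤ N)
    (hh : IsVolterraKernel T M h) (hΛ : 0 < Λ)
    (hΛb : ∀ a b : ℝ, a < b → ∀ (u : ℝ → ℝ) (B : ℝ), (∀ t ∈ cellNodes r a b, |u t| ≤ B) →
      ∀ t ∈ Icc a b, |(nodeInterp r a b u).eval t| ≤ Λ * B)
    (hl : 0 < lam) (hlM : 6 * (Λ * M) ≤ lam) (hlN : lam * (T / N) ≤ 1)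
    (hx : ContinuousOn x (Icc 0 T)) (hsx : SolvesSecondKind T h f x)
    (hyc : ContinuousOn y (Icc 0 T)) (hy : IsCollocationSpline T r N h f y)
    (hD : ∀ k < N, ∃ q : ℝ[X], q.degree < (r : WithBot ℕ) ∧
      ∀ t ∈ Icc (gridPt T N k) (gridPt T N (k + 1)), |x t - q.eval t| ≤ D)
    {t : ℝ} (ht : t ∈ Icc 0 T) : |x t - y t| ≤ 2 * ((1 + Λ) * D) * Real.exp (lam * T) := by
  -- The weighted error is bounded at a point `τ` where it is largest, using only the cell that
  -- contains `τ`.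
  set w : ℝ → ℝ := fun t => Real.exp (-(lam * t)) * |x t - y t| with hw
  have hwc : ContinuousOn w (Icc 0 T) :=
    (by fun_prop : Continuous fun t : ℝ => Real.exp (-(lam * t))).continuousOn.mul
      (hx.sub hyc).abs
  obtain ⟨τ, hτ, hmax⟩ := isCompact_Icc.exists_isMaxOn (nonempty_Icc.mpr hT.le) hwc
  have hW0 : 0 ≤ w τ := mul_nonneg (Real.exp_pos _).le (abs_nonneg _)
  have habs : ∀ t, |x t - y t| = w t * Real.exp (lam * t) := fun t => by
    simp only [hw]
    rw [mul_right_comm, ← Real.exp_add]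
    simp
  have herr : ∀ s ∈ Icc 0 T, |x s - y s| ≤ w τ * Real.exp (lam * s) := fun s hs => by
    rw [habs s]
    exact mul_le_mul_of_nonneg_right (hmax hs) (Real.exp_pos _).le
  obtain ⟨k, hk, hkτ⟩ := exists_mem_cell_of_mem hN hτ
  have hab := gridPt_lt_succ hT hN k
  have hsub := gridPt_succ_sub (T := T) (N := N) k
  set a := gridPt T N k
  set b := gridPt T N (k + 1)
  obtain ⟨q, hqd, hq⟩ := hD k hk
  have hD0 : 0 ≤ D := (abs_nonneg _).trans (hq τ hkτ)
  obtain ⟨p, -, hpy, hp⟩ := hy.exists_cell_poly hT hN hh hx hsx hyc hk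
  -- Interpolation reproduces `q`, so `p - q` interpolates small data: the approximation error of
  -- `q` and the Volterra integral of the error.
  have hpq : p - q = nodeInterp r a b fun t =>
      (x t - q.eval t) - ∫ s in (0 : ℝ)..t, h t s * (x s - y s) := by
    conv_lhs => rw [hp, ← nodeInterp_poly (r := r) (a := a) (b := b) hr hab hqd]
    rw [nodeInterp, nodeInterp, ← map_sub]
    refine nodeInterp_congr fun t _ => ?_
    simp only [Pi.sub_apply]
    ring
  have hbd : ∀ t ∈ cellNodes r a b, |(x t - q.eval t) - ∫ s in (0 : ℝ)..t, h t s * (x s - y s)| ≤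
      D + M * w τ / lam * Real.exp (lam * b) := by
    intro t ht
    have htc := cellNodes_subset hab.le ht
    have htI := cell_subset hT hN hk htc
    refine (abs_sub _ _).trans (add_le_add (hq t htc) ?_)
    refine (hh.abs_integral_le_exp hl hW0 htI fun s hs =>
      herr s (Icc_subset_Icc_right htI.2 hs)).trans ?_
    have h1 := htc.2
    have h2 := hh.nonneg
    gcongr
  have h1 := hΛb a b hab _ _ hbd τ hkτ
  rw [← hpq, eval_sub] at h1
  have h2 : |x τ - y τ| ≤ D + Λ * (D + M * w τ / lam * Real.exp (lam * b)) := by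
    rw [hpy τ hkτ]
    have : x τ - p.eval τ = (x τ - q.eval τ) - (p.eval τ - q.eval τ) := by ring
    rw [this]
    exact (abs_sub _ _).trans (add_le_add (hq τ hkτ) h1)
  -- Since `b - τ ≤ T/N` and `λT/N ≤ 1`, the weight varies over the cell by a factor of at most `e ≤
  -- 3`.
  have h3 : Real.exp (-(lam * τ)) * Real.exp (lam * b) ≤ 3 := by
    rw [← Real.exp_add]
    refine (Real.exp_le_exp.mpr ?_).trans (Real.exp_one_lt_d9.le.trans (by norm_num))
    have := hkτ.1
    nlinarith
  have h4 : Real.exp (-(lam * τ)) ≤ 1 := by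
    rw [Real.exp_le_one_iff]
    have := mul_nonneg hl.le hτ.1
    linarith
  -- From `λ ≥ 6ΛM` the Volterra term is at most `(1/6)·3` times the maximal weighted error; this
  -- half is absorbed on the left.
  have h5 : w τ ≤ (1 + Λ) * D + w τ / 2 := by
    have h6 : w τ ≤ Real.exp (-(lam * τ)) * (D + Λ * (D + M * w τ / lam * Real.exp (lam * b))) :=
      mul_le_mul_of_nonneg_left h2 (Real.exp_pos _).le
    have h7 : Real.exp (-(lam * τ)) * (D + Λ * (D + M * w τ / lam * Real.exp (lam * b))) =
        Real.exp (-(lam * τ)) * ((1 + Λ) * D) +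
        Λ * M / lam * w τ * (Real.exp (-(lam * τ)) * Real.exp (lam * b)) := by ring
    have h8 : Λ * M / lam ≤ 1 / 6 := by
      rw [div_le_div_iff₀ hl (by norm_num)]
      linarith
    have h9 : Λ * M / lam * w τ * (Real.exp (-(lam * τ)) * Real.exp (lam * b)) ≤
        1 / 6 * w τ * 3 := by
      have := hh.nonneg
      gcongr
    have h10 : Real.exp (-(lam * τ)) * ((1 + Λ) * D) ≤ (1 + Λ) * D :=
      mul_le_of_le_one_left (by positivity) h4
    linarith
  refine (herr t ht).trans (mul_le_mul (by linarith) ?_ (Real.exp_pos _).le (by positivity))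
  exact Real.exp_le_exp.mpr (mul_le_mul_of_nonneg_left ht.2 hl.le)

end Error

/-! ### The maximum norm -/

section MaxNorm

variable {T : ℝ} {u : ℝ → ℝ}

lemma abs_le_cNorm (hu : ContinuousOn u (Icc 0 T)) {t : ℝ} (ht : t ∈ Icc 0 T) :
    |u t| ≤ cNorm T u :=
  le_csSup (isCompact_Icc.image_of_continuousOn hu.abs).bddAbove (mem_image_of_mem _ ht)

lemma cNorm_le (hT : 0 ≤ T) {B : ℝ} (h : ∀ t ∈ Icc 0 T, |u t| ≤ B) : cNorm T u ≤ B := by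
  refine csSup_le ((nonempty_Icc.mpr hT).image _) ?_
  rintro _ ⟨t, ht, rfl⟩
  exact h t ht

end MaxNorm

/-! ### Piecewise polynomial approximation from above and below -/

section Approximation

variable {T a b L : ℝ} {r : ℕ} {x : ℝ → ℝ}

/-- Taylor polynomials approximate on subintervals. -/
lemma exists_taylor_poly (hT : 0 < T) (hr : 1 ≤ r) (hx : ContDiffOn ℝ r x (Icc 0 T))
    (hL : ∀ t ∈ Icc 0 T, |iteratedDerivWithin r x (Icc 0 T) t| ≤ L) (ha : 0 ≤ a) (hab : a < b)
    (hb : b ≤ T) :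
    ∃ q : ℝ[X], q.degree < (r : WithBot ℕ) ∧
      ∀ t ∈ Icc a b, |x t - q.eval t| ≤ L * (b - a) ^ r / ((r - 1).factorial : ℝ) := by
  obtain ⟨m, rfl⟩ : ∃ m, r = m + 1 := ⟨r - 1, by omega⟩
  have hsub : Icc a b ⊆ Icc 0 T := Icc_subset_Icc ha hb
  have hL0 : 0 ≤ L := (abs_nonneg _).trans (hL 0 ⟨le_rfl, hT.le⟩)
  refine ⟨∑ k ∈ Finset.range (m + 1), C ((k.factorial : ℝ)⁻¹ *
    iteratedDerivWithin k x (Icc a b) a) * (X - C a) ^ k, ?_, fun t ht => ?_⟩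
  · rw [← mem_degreeLT]
    refine Submodule.sum_mem _ fun k hk => ?_
    rw [← smul_eq_C_mul]
    refine Submodule.smul_mem _ _ (mem_degreeLT.mpr ?_)
    rw [degree_pow, degree_X_sub_C]
    rw [nsmul_one]
    exact_mod_cast Finset.mem_range.mp hk
  -- This remainder bound has `(r - 1)!` in place of `r!`; the lost factor `r` is paid for by the
  -- final constant.
  · have h1 := taylor_mean_remainder_bound (f := x) (C := L) (n := m) hab.le
      (by exact_mod_cast hx.mono hsub) ht (fun y hy => by
        have h2 : iteratedDerivWithin (m + 1) x (Icc a b) y =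
            iteratedDerivWithin (m + 1) x (Icc 0 T) y := by
          rw [iteratedDerivWithin, iteratedDerivWithin, iteratedFDerivWithin_subset hsub
            (uniqueDiffOn_Icc hab) (uniqueDiffOn_Icc hT) hx hy]
        rw [h2]
        exact hL y (hsub hy))
    have h3 : taylorWithinEval x m (Icc a b) a t =
        (∑ k ∈ Finset.range (m + 1), C ((k.factorial : ℝ)⁻¹ *
          iteratedDerivWithin k x (Icc a b) a) * (X - C a) ^ k).eval t := by
      rw [taylor_within_apply, eval_finsetSum]
      refine Finset.sum_congr rfl fun k _ => ?_
      simp only [eval_mul, eval_C, eval_pow, eval_sub, eval_X, smul_eq_mul]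
      ring
    rw [← h3, ← Real.norm_eq_abs]
    refine h1.trans ?_
    have h4 := ht.1
    have h5 := ht.2
    have h6 : t - a ≤ b - a := by linarith
    have h7 : 0 ≤ t - a := by linarith
    rw [Nat.add_sub_cancel]
    gcongr

/-- A lower bound for a function with large `m`-th derivative, by finite differences. -/
lemma le_of_le_iterated_deriv (m : ℕ) {U : ℕ → ℝ → ℝ} {a d μ ε : ℝ} (hd : 0 ≤ d)
    (hU : ∀ j < m, ∀ t ∈ Icc a (a + m * d),
      HasDerivWithinAt (U j) (U (j + 1) t) (Icc a (a + m * d)) t)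
    (hμ : ∀ t ∈ Icc a (a + m * d), μ ≤ U m t) (hε : ∀ t ∈ Icc a (a + m * d), |U 0 t| ≤ ε) :
    μ * d ^ m ≤ 2 ^ m * ε := by
  induction m generalizing U μ ε with
  | zero =>
    have ha : a ∈ Icc a (a + (0 : ℕ) * d) := by simp
    simpa using (hμ a ha).trans ((le_abs_self _).trans (hε a ha))
  | succ m ih =>
    have hlen : a + (m + 1 : ℕ) * d = a + m * d + d := by
      push_cast
      ring
    rw [hlen] at hU hμ hε
    have hsub : Icc a (a + m * d) ⊆ Icc a (a + m * d + d) := Icc_subset_Icc_right (by linarith)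
    have hshift : MapsTo (fun t => t + d) (Icc a (a + m * d)) (Icc a (a + m * d + d)) :=
      fun t ht => ⟨by linarith [ht.1], by linarith [ht.2]⟩
    -- Passing to differences `U_j(t + d) - U_j(t)` uses up one derivative: by the mean value
    -- inequality the lower bound `μ` becomes `μd`, while `ε` becomes at most `2ε`.
    have key := ih (U := fun j t => U j (t + d) - U j t) (μ := μ * d) (ε := 2 * ε) ?_ ?_ ?_
    · rw [pow_succ, pow_succ]
      linarith
    · intro j hj t ht
      have h1 := (hU j (by omega) _ (hshift ht)).comp t
        ((hasDerivWithinAt_id t (Icc a (a + m * d))).add_const d) hshift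
      rw [mul_one] at h1
      exact h1.sub ((hU j (by omega) t (hsub ht)).mono hsub)
    · intro t ht
      have hcont : ContinuousOn (U m) (Icc a (a + m * d + d)) := fun s hs =>
        (hU m (by omega) s hs).continuousWithinAt
      have hder : ∀ s ∈ interior (Icc a (a + m * d + d)), HasDerivAt (U m) (U (m + 1) s) s :=
        fun s hs => (hU m (by omega) s (interior_subset hs)).hasDerivAt
          (mem_interior_iff_mem_nhds.mp hs)
      have h1 := (convex_Icc a (a + m * d + d)).mul_sub_le_image_sub_of_le_deriv hcont
        (fun s hs => (hder s hs).differentiableAt.differentiableWithinAt)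
        (C := μ) (fun s hs => by
          rw [(hder s hs).deriv]
          exact hμ s (interior_subset hs)) t (hsub ht) (t + d) (hshift ht) (by linarith)
      simpa using h1
    · intro t ht
      refine (abs_sub _ _).trans ?_
      linarith [hε _ (hshift ht), hε t (hsub ht)]

lemma hasDerivWithinAt_iteratedDerivWithin (hT : 0 < T) (hx : ContDiffOn ℝ r x (Icc 0 T)) {j : ℕ}
    (hj : j < r) {t : ℝ} (ht : t ∈ Icc 0 T) :
    HasDerivWithinAt (iteratedDerivWithin j x (Icc 0 T))
      (iteratedDerivWithin (j + 1) x (Icc 0 T) t) (Icc 0 T) t := by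
  rw [iteratedDerivWithin_succ]
  exact (hx.differentiableOn_iteratedDerivWithin (by exact_mod_cast hj)
    (uniqueDiffOn_Icc hT) t ht).hasDerivWithinAt

/-- Polynomials of degree less than `r` do not approximate well a function whose `r`-th
derivative is bounded away from zero. -/
lemma le_approximation_error (hT : 0 < T) (hr : 1 ≤ r) (hx : ContDiffOn ℝ r x (Icc 0 T))
    {σ μ ε : ℝ} (hσ : |σ| = 1) (ha : 0 ≤ a) (hab : a ≤ b) (hb : b ≤ T)
    (hμ : ∀ t ∈ Icc a b, μ ≤ σ * iteratedDerivWithin r x (Icc 0 T) t) {p : ℝ[X]}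
    (hp : p.degree < (r : WithBot ℕ)) (hε : ∀ t ∈ Icc a b, |x t - p.eval t| ≤ ε) :
    μ * ((b - a) / r) ^ r ≤ 2 ^ r * ε := by
  have hr0 : (r : ℝ) ≠ 0 := by exact_mod_cast (by omega : r ≠ 0)
  have hlen : a + r * ((b - a) / r) = b := by
    field_simp
    ring
  have hsub : Icc a b ⊆ Icc 0 T := Icc_subset_Icc ha hb
  have hpr : derivative^[r] p = 0 := by
    rcases eq_or_ne p 0 with rfl | h0
    · simp
    · exact iterate_derivative_eq_zero ((natDegree_lt_iff_degree_lt h0).mpr hp)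
  -- The functions are the derivatives of `σ(x - p)`. The polynomial drops out at order `r`, and `r`
  -- steps of length `(b - a)/r` fill the interval.
  refine le_of_le_iterated_deriv r (a := a) (U := fun j t =>
    σ * (iteratedDerivWithin j x (Icc 0 T) t - (derivative^[j] p).eval t)) ?_ ?_ ?_ ?_
  · have := sub_nonneg.mpr hab
    positivity
  · rw [hlen]
    intro j hj t ht
    refine HasDerivWithinAt.const_mul σ (HasDerivWithinAt.sub ?_ ?_)
    · exact (hasDerivWithinAt_iteratedDerivWithin hT hx hj (hsub ht)).mono hsub
    · rw [Function.iterate_succ_apply']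
      exact ((derivative^[j] p).hasDerivAt t).hasDerivWithinAt
  · rw [hlen]
    intro t ht
    simpa [hpr] using hμ t ht
  · rw [hlen]
    intro t ht
    simpa [abs_mul, hσ] using hε t ht

/-- If `x` is not a polynomial of degree less than `r`, then `x^{(r)}` is bounded away from zero
on some interval. -/
lemma exists_interval_deriv_ge (hT : 0 < T) (hr : 1 ≤ r) (hx : ContDiffOn ℝ r x (Icc 0 T))
    (hnp : ¬ ∃ p : ℝ[X], p.degree < (r : WithBot ℕ) ∧ ∀ t ∈ Icc 0 T, x t = p.eval t) :
    ∃ a b σ μ : ℝ, 0 ≤ a ∧ a < b ∧ b ≤ T ∧ |σ| = 1 ∧ 0 < μ ∧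
      ∀ t ∈ Icc a b, μ ≤ σ * iteratedDerivWithin r x (Icc 0 T) t := by
  -- If `x^{(r)}` vanished identically, the Taylor estimate with `L = 0` would make `x` a polynomial
  -- of degree below `r`.
  obtain ⟨τ, hτ, hne⟩ : ∃ τ ∈ Icc 0 T, iteratedDerivWithin r x (Icc 0 T) τ ≠ 0 := by
    by_contra! hcon
    obtain ⟨q, hq, hqx⟩ := exists_taylor_poly (L := 0) hT hr hx
      (fun t ht => by rw [hcon t ht, abs_zero]) le_rfl hT le_rfl
    refine hnp ⟨q, hq, fun t ht => ?_⟩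
    have := hqx t ht
    rw [zero_mul, zero_div] at this
    exact sub_eq_zero.mp (abs_eq_zero.mp (le_antisymm this (abs_nonneg _)))
  set v := iteratedDerivWithin r x (Icc 0 T) with hv
  obtain ⟨σ, hσ, hσv⟩ : ∃ σ : ℝ, |σ| = 1 ∧ σ * v τ = |v τ| := by
    rcases le_total 0 (v τ) with h | h
    · exact ⟨1, by simp, by rw [one_mul, abs_of_nonneg h]⟩
    · exact ⟨-1, by simp, by rw [neg_one_mul, abs_of_nonpos h]⟩
  have hvc : ContinuousOn v (Icc 0 T) :=
    hx.continuousOn_iteratedDerivWithin le_rfl (uniqueDiffOn_Icc hT)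
  have hpos := abs_pos.mpr hne
  obtain ⟨δ, hδ, hδv⟩ := Metric.continuousWithinAt_iff.mp (hvc τ hτ) (|v τ| / 2) (half_pos hpos)
  refine ⟨max 0 (τ - δ / 2), min T (τ + δ / 2), σ, |v τ| / 2, le_max_left _ _, ?_,
    min_le_left _ _, hσ, half_pos hpos, fun t ht => ?_⟩
  · rw [max_lt_iff, lt_min_iff, lt_min_iff]
    exact ⟨⟨hT, by linarith [hτ.1]⟩, by linarith [hτ.2], by linarith⟩
  · have h1 := (le_max_left _ _).trans ht.1
    have h2 := (le_max_right _ _).trans ht.1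
    have h3 := ht.2.trans (min_le_left _ _)
    have h4 := ht.2.trans (min_le_right _ _)
    have h5 := hδv (x := t) ⟨h1, h3⟩ (by
      rw [Real.dist_eq, abs_lt]
      constructor <;> linarith)
    rw [Real.dist_eq] at h5
    have h6 : |σ * (v t - v τ)| < |v τ| / 2 := by rwa [abs_mul, hσ, one_mul]
    have h7 := (abs_lt.mp h6).1
    linarith [mul_sub σ (v t) (v τ)]

/-- Piecewise polynomials on `N` cells approximate `x` no better than of order `N^{-r}`. -/
lemma exists_lower_bound (hT : 0 < T) (hr : 1 ≤ r) (hx : ContDiffOn ℝ r x (Icc 0 T))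
    (hnp : ¬ ∃ p : ℝ[X], p.degree < (r : WithBot ℕ) ∧ ∀ t ∈ Icc 0 T, x t = p.eval t) :
    ∃ c : ℝ, 0 < c ∧ ∀ N ≥ 1, ∀ (y : ℝ → ℝ) (ε : ℝ), (∀ k < N, ∃ p : ℝ[X],
      p.degree < (r : WithBot ℕ) ∧
        ∀ t ∈ Icc (gridPt T N k) (gridPt T N (k + 1)), y t = p.eval t) →
      (∀ t ∈ Icc 0 T, |x t - y t| ≤ ε) → c * ((N : ℝ) ^ r)⁻¹ ≤ ε := by
  obtain ⟨a, b, σ, μ, ha, hab, hb, hσ, hμ, hv⟩ := exists_interval_deriv_ge hT hr hx hnp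
  have hr0 : (0 : ℝ) < r := by exact_mod_cast hr
  -- With this `l`, a window of length `l/N` fits into either half of `[a,b]` and is no longer than
  -- half a cell, for every `N ≥ 1`.
  set l := min (b - a) T / 2 with hl
  have hl0 : 0 < l := half_pos (lt_min (sub_pos.mpr hab) hT)
  have hl1 : l ≤ (b - a) / 2 := by
    have := min_le_left (b - a) T
    linarith
  have hl2 : l ≤ T / 2 := by
    have := min_le_right (b - a) T
    linarith
  refine ⟨μ * (l / (2 * r)) ^ r, by positivity, fun N hN y ε hy hε => ?_⟩
  have hN0 : (0 : ℝ) < N := by exact_mod_cast hN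
  have hN1 : (1 : ℝ) ≤ N := by exact_mod_cast hN
  set d := l / N with hd
  have hd0 : 0 < d := div_pos hl0 hN0
  have hd1 : d ≤ (b - a) / 2 := (div_le_self hl0.le hN1).trans hl1
  have hd2 : d ≤ T / N / 2 := by
    rw [div_right_comm]
    exact div_le_div_of_nonneg_right hl2 hN0.le
  have hm : (a + b) / 2 ∈ Icc 0 T := ⟨by linarith, by linarith⟩
  obtain ⟨k, hk, hkm⟩ := exists_mem_cell_of_mem hN hm
  obtain ⟨p, hp, hpy⟩ := hy k hk
  have hsub := gridPt_succ_sub (T := T) (N := N) k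
  have hkI := cell_subset hT hN hk
  -- The midpoint of `[a,b]` leaves at least half of its cell on one side; the window starts or ends
  -- at the midpoint accordingly and so avoids all other cells.
  obtain ⟨a', ha1, ha2, hb1, hb2⟩ : ∃ a', a ≤ a' ∧ gridPt T N k ≤ a' ∧ a' + d ≤ b ∧
      a' + d ≤ gridPt T N (k + 1) := by
    rcases le_total ((a + b) / 2 - gridPt T N k) (T / N / 2) with h | h
    · exact ⟨(a + b) / 2, by linarith, hkm.1, by linarith, by linarith⟩
    · exact ⟨(a + b) / 2 - d, by linarith, by linarith, by linarith, by linarith [hkm.2]⟩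
  have key := le_approximation_error (a := a') (b := a' + d) (ε := ε) hT hr hx hσ (by linarith)
    (by linarith) (by linarith) (fun t ht => hv t ⟨ha1.trans ht.1, ht.2.trans hb1⟩) hp
    fun t ht => by
      have htc : t ∈ Icc (gridPt T N k) (gridPt T N (k + 1)) := ⟨ha2.trans ht.1, ht.2.trans hb2⟩
      rw [← hpy t htc]
      exact hε t (hkI htc)
  have h1 : μ * (l / (2 * r)) ^ r * ((N : ℝ) ^ r)⁻¹ = μ * (d / r) ^ r / 2 ^ r := by
    rw [hd]
    simp only [div_pow, mul_pow]
    field_simp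
  rw [h1, div_le_iff₀ (by positivity), mul_comm ε]
  simpa using key

end Approximation

end VolterraSpline

end

/-! ### Assembly of the constants -/

open VolterraSpline in
theorem mainTheorem2 (T : ℝ) (hT : 0 < T) (r : ℕ) (hr : 2 ≤ r) (n : ℕ) (hn : 1 ≤ n)
    (α : ℕ → ℝ → ℝ) (hα : VolterraSpline.CurveSystem T r n α)
    (K : ℕ → ℝ → ℝ → ℝ)
    (hK : ∀ i, 1 ≤ i → i ≤ n → VolterraSpline.MixedC T (r + 1) r (K i))
    (hdiag : ∀ t ∈ Set.Icc 0 T, K n t t ≠ 0) :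
    ∃ A : ℝ, 0 < A ∧ ∃ N₀ : ℕ, 1 ≤ N₀ ∧
      ∀ g : ℝ → ℝ, ContDiffOn ℝ ((r + 1 : ℕ) : WithTop ℕ∞) g (Set.Icc 0 T) → g 0 = 0 →
        -- the two equations agree for every function on which the jump terms vanish
        (∀ z : ℝ → ℝ, ContinuousOn z (Set.Icc 0 T) →
          (∀ t ∈ Set.Icc 0 T, VolterraSpline.jumpTerm T n α K z t = 0) →
          (VolterraSpline.SolvesFirstKind T n α K g z ↔
            VolterraSpline.SolvesSecondKind T (VolterraSpline.resKernel T n α K)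
              (VolterraSpline.resRhs T n K g) z)) ∧
        -- the exact solution
        ∃ x : ℝ → ℝ, ContDiffOn ℝ r x (Set.Icc 0 T) ∧
          VolterraSpline.SolvesSecondKind T (VolterraSpline.resKernel T n α K)
            (VolterraSpline.resRhs T n K g) x ∧
          (∀ z : ℝ → ℝ, ContinuousOn z (Set.Icc 0 T) →
            VolterraSpline.SolvesSecondKind T (VolterraSpline.resKernel T n α K)
              (VolterraSpline.resRhs T n K g) z → Set.EqOn z x (Set.Icc 0 T)) ∧
          -- the approximate solutions
          (∀ N ≥ N₀, ∃ y : ℝ → ℝ, ContinuousOn y (Set.Icc 0 T) ∧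
            VolterraSpline.IsCollocationSpline T r N (VolterraSpline.resKernel T n α K)
              (VolterraSpline.resRhs T n K g) y ∧
            ∀ z : ℝ → ℝ, VolterraSpline.IsCollocationSpline T r N
              (VolterraSpline.resKernel T n α K) (VolterraSpline.resRhs T n K g) z →
                Set.EqOn z y (Set.Icc 0 T)) ∧
          -- the upper estimate, with a constant that does not depend on the right-hand side
          (∀ N ≥ N₀, ∀ y : ℝ → ℝ, VolterraSpline.IsCollocationSpline T r N
              (VolterraSpline.resKernel T n α K) (VolterraSpline.resRhs T n K g) y →
            VolterraSpline.cNorm T (fun t => x t - y t) ≤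
              A * (VolterraSpline.cNorm T (iteratedDerivWithin r x (Set.Icc 0 T)) *
                (T / N) ^ r / (r.factorial : ℝ))) ∧
          -- the two-sided estimate
          ((¬ ∃ p : Polynomial ℝ, p.degree < (r : WithBot ℕ) ∧
              ∀ t ∈ Set.Icc 0 T, x t = p.eval t) →
            ∃ c : ℝ, 0 < c ∧ ∃ C : ℝ, 0 < C ∧
              ∀ N ≥ N₀, ∀ y : ℝ → ℝ, VolterraSpline.IsCollocationSpline T r N
                  (VolterraSpline.resKernel T n α K) (VolterraSpline.resRhs T n K g) y →
                c * ((N : ℝ) ^ r)⁻¹ ≤ VolterraSpline.cNorm T (fun t => x t - y t) ∧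
                VolterraSpline.cNorm T (fun t => x t - y t) ≤ C * ((N : ℝ) ^ r)⁻¹) := by
  have hr1 : 1 ≤ r := by omega
  obtain ⟨M, hh⟩ := exists_isVolterraKernel_resKernel hT hn hα hK hdiag
  obtain ⟨Λ, hΛ, hΛb⟩ := exists_lebesgue_constant hr
  have hM := hh.nonneg
  set lam : ℝ := 6 * (Λ * M) + 1 with hlam
  have hl : 0 < lam := by positivity
  -- `N ≥ λT` controls the weight within a cell, and since `ΛM < λ` it also makes the cell equations
  -- uniquely solvable.
  have hgrid : ∀ N ≥ max 1 ⌈lam * T⌉₊, 1 ≤ N ∧ lam * (T / N) ≤ 1 ∧ Λ * M * (T / N) < 1 := by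
    intro N hN
    have hN1 : 1 ≤ N := (le_max_left _ _).trans hN
    have hN0 : (0 : ℝ) < N := by exact_mod_cast hN1
    have h1 : lam * T ≤ N := (Nat.le_ceil _).trans (by exact_mod_cast (le_max_right _ _).trans hN)
    have h2 : lam * (T / N) ≤ 1 := by
      rw [← mul_div_assoc, div_le_one hN0]
      exact h1
    have h3 : 0 < T / N := div_pos hT hN0
    have h4 : 0 ≤ Λ * M * (T / N) := by positivity
    exact ⟨hN1, h2, by nlinarith⟩
  -- The constant from the stability estimate, times the factor `r` that turns `(r - 1)!` into `r!`.
  refine ⟨2 * (1 + Λ) * Real.exp (lam * T) * r, by positivity, max 1 ⌈lam * T⌉₊,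
    le_max_left _ _, fun g hg hg0 => ⟨fun z hz hj => ?_, ?_⟩⟩
  · exact solvesFirstKind_iff hT hn hα hK hdiag hr1 (hg.differentiableOn (by simp)) hg0 hz hj
  have hf := contDiffOn_resRhs hT hn hK hdiag hg
  obtain ⟨x, hxc, hsx, huniq⟩ := hh.exists_solution hT.le hf.continuousOn
  have hx := hsx.contDiffOn hT hn hα hK hdiag hf hxc
  set L := cNorm T (iteratedDerivWithin r x (Set.Icc 0 T)) with hL
  have hLb : ∀ t ∈ Set.Icc 0 T, |iteratedDerivWithin r x (Set.Icc 0 T) t| ≤ L := fun t ht =>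
    abs_le_cNorm (hx.continuousOn_iteratedDerivWithin le_rfl (uniqueDiffOn_Icc hT)) ht
  have hL0 : 0 ≤ L := (abs_nonneg _).trans (hLb 0 ⟨le_rfl, hT.le⟩)
  have hupper : ∀ N ≥ max 1 ⌈lam * T⌉₊, ∀ y : ℝ → ℝ, IsCollocationSpline T r N
      (resKernel T n α K) (resRhs T n K g) y →
      cNorm T (fun t => x t - y t) ≤ 2 * (1 + Λ) * Real.exp (lam * T) * r *
        (L * (T / N) ^ r / (r.factorial : ℝ)) := by
    intro N hN y hy
    obtain ⟨hN1, hlN, hsmall⟩ := hgrid N hN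
    have hyc := hy.continuousOn hT hr hN1 hh hΛb hsmall
    refine cNorm_le hT.le fun t ht => ?_
    refine (hy.abs_sub_le hT hr hN1 hh hΛ hΛb hl (by linarith) hlN hxc hsx hyc
      (D := L * (T / N) ^ r / ((r - 1).factorial : ℝ)) (fun k hk => ?_) ht).trans_eq ?_
    · rw [← gridPt_succ_sub (T := T) (N := N) k]
      exact exists_taylor_poly hT hr1 hx hLb (gridPt_mem hT hN1 hk.le).1
        (gridPt_lt_succ hT hN1 k) (gridPt_mem hT hN1 hk).2
    · have hfac : (r.factorial : ℝ) = r * ((r - 1).factorial : ℝ) := by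
        exact_mod_cast (Nat.mul_factorial_pred (by omega : r ≠ 0)).symm
      have hr0 : (r : ℝ) ≠ 0 := by exact_mod_cast (by omega : r ≠ 0)
      have hf0 : ((r - 1).factorial : ℝ) ≠ 0 := by exact_mod_cast Nat.factorial_ne_zero _
      rw [hfac]
      field_simp
  refine ⟨x, hx, hsx, huniq, fun N hN => ?_, hupper, fun hnp => ?_⟩
  · obtain ⟨hN1, -, hsmall⟩ := hgrid N hN
    obtain ⟨y, hyc, hy⟩ := exists_collocationSpline hT hr hN1 hh hΛb hsmall (resRhs T n K g)
    exact ⟨y, hyc, hy, fun z hz => hz.eqOn hT hN1 hh hΛb hsmall hy⟩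
  · obtain ⟨c, hc, hlow⟩ := exists_lower_bound hT hr1 hx hnp
    -- The summand `1` makes `C` positive without first showing that `L` is nonzero.
    refine ⟨c, hc, 2 * (1 + Λ) * Real.exp (lam * T) * r * (L * T ^ r / (r.factorial : ℝ)) + 1,
      by positivity, fun N hN y hy => ⟨?_, (hupper N hN y hy).trans ?_⟩⟩
    · obtain ⟨hN1, -, hsmall⟩ := hgrid N hN
      have hyc := hy.continuousOn hT hr hN1 hh hΛb hsmall
      refine hlow N hN1 y _ (fun k hk => ?_) fun t ht =>
        abs_le_cNorm (u := fun t => x t - y t) (hxc.sub hyc) ht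
      obtain ⟨p, hp, hpy, -⟩ := hy k hk
      exact ⟨p, hp, hpy⟩
    · have h1 : (0 : ℝ) ≤ ((N : ℝ) ^ r)⁻¹ := by positivity
      calc 2 * (1 + Λ) * Real.exp (lam * T) * r * (L * (T / N) ^ r / (r.factorial : ℝ))
          = 2 * (1 + Λ) * Real.exp (lam * T) * r * (L * T ^ r / (r.factorial : ℝ)) *
              ((N : ℝ) ^ r)⁻¹ := by
            rw [div_pow, div_eq_mul_inv (T ^ r)]
            ring
        _ ≤ _ := mul_le_mul_of_nonneg_right (le_add_of_nonneg_right zero_le_one) h1
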